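/- Let $K$ be a compact Hausdorff space, let $\varphi : K \to K$ be a homeomorphism of $K$ onto its image $\varphi(K)$ with $\varphi(K) \subsetneq K$, let $w \in C(K)$ (complex-valued continuous functions with the supremum norm), and let $T$ be the weighted composition operator $(Tf)(k) = w(k) f(\varphi(k))$ on $C(K)$. Put $L = \bigcap_{n \ge 0} \varphi^n(K)$ and $M = K \setminus \mathrm{Int}_K L$. For a closed set $A \subseteq K$ with $\varphi(A) \subseteq A$, the same formula (for $k \in A$) defines the operator $T$ on $C(A)$; $\sigma(T, C(A))$ and $\rho(T, C(A))$ denote its spectrum and spectral radius, and $\sigma(T) = \sigma(T, C(K))$. A bounded operator is upper semi-Fredholm if its range is closed and its kernel is finite-dimensional. Let $\lambda \in \sigma(T) \setminus \{0\}$. The operator $\lambda I - T$ on $C(K)$ is upper semi-Fredholm if and only if (a) $\lambda I - T$ is upper semi-Fredholm on $C(L)$, and (b) $M$ is the union of two disjoint closed sets $M_1$, $M_2$ with $\varphi(M_i) \subseteq M_i$ ($i = 1, 2$) such that (c) if $M_1 \neq \emptyset$, then $\rho(T, C(M_1)) < |\lambda|$, and (d) if $M_2 \neq \emptyset$, then,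 with $N_2 = \bigcap_{n \ge 0} \varphi^n(M_2)$, the operator $T$ is invertible on $C(N_2)$, $|\lambda| < 1/\rho(T^{-1}, C(N_2))$, and the set $M_2 \setminus \varphi(M_2)$ is finite. Moreover, if $\lambda I - T$ is upper semi-Fredholm, then for all $M_1$, $M_2$ as in (b)–(d), $$\dim \ker(\lambda I - T) = \dim \ker(\lambda I - T, C(L)) + \mathrm{card}(M_2 \setminus \varphi(M_2)),$$ where $\ker(\lambda I - T, C(L))$ is the kernel of $\lambda I - T$ on $C(L)$. -/

import Mathlib

open Set

/-- A bounded operator is upper semi-Fredholm if its kernel is finite-dimensional and its range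
is closed. -/
def IsUpperSemiFredholm {E : Type*} [AddCommGroup E] [Module ℂ E] [TopologicalSpace E]
    (T : E →L[ℂ] E) : Prop :=
  FiniteDimensional ℂ (LinearMap.ker (T : E →ₗ[ℂ] E)) ∧ IsClosed (Set.range T)

theorem continuous_mul_left_fixed {X : Type*} [TopologicalSpace X] (w : C(X, ℂ)) :
    Continuous fun f : C(X, ℂ) => w * f := by
  refine continuous_iff_continuousAt.2 fun f => ?_
  refine (ContinuousMap.tendsto_compactOpen_iff_forall _ _).2 fun s hs => ?_
  have := isCompact_iff_compactSpace.1 hs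
  exact ((continuous_const (y := w.restrict s)).mul
    (ContinuousMap.continuous_restrict s)).tendsto f

/-- The weighted composition operator `(T f)(x) = w(x) f(φ(x))` on `C(X)`.
For compact `X` the topology of `C(X, ℂ)` is that of the supremum norm. -/
noncomputable def weightedComp {X : Type*} [TopologicalSpace X] (φ : C(X, X)) (w : C(X, ℂ)) :
    C(X, ℂ) →L[ℂ] C(X, ℂ) where
  toFun f := w * f.comp φ
  map_add' f g := by ext x; simp [mul_add]
  map_smul' c f := by ext x; simp [mul_left_comm]
  cont := (continuous_mul_left_fixed w).comp (ContinuousMap.continuous_precomp φ)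

/-- The action of `T = w T_φ` on `C(A)`, where `A` is a `φ`-invariant subset: the weighted
composition operator given by the restrictions of `φ` and `w` to `A`. -/
noncomputable def weightedCompOn {X : Type*} [TopologicalSpace X] (φ : C(X, X)) (w : C(X, ℂ))
    (A : Set X) (hA : MapsTo φ A A) : C(A, ℂ) →L[ℂ] C(A, ℂ) :=
  weightedComp ⟨hA.restrict φ A A, φ.continuous.restrict hA⟩ (w.restrict A)

/-- The set `⋂ n, φⁿ(A)`. -/
def iterInter {X : Type*} (φ : X → X) (A : Set X) : Set X :=
  ⋂ n : ℕ, φ^[n] '' A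

theorem mapsTo_iterInter {X : Type*} {φ : X → X} {A : Set X} (hA : MapsTo φ A A) :
    MapsTo φ (iterInter φ A) (iterInter φ A) := by
  intro x hx
  refine mem_iInter.2 fun n => ?_
  obtain ⟨a, ha, rfl⟩ := mem_iInter.1 hx n
  exact ⟨φ a, hA ha, by rw [← Function.iterate_succ_apply, Function.iterate_succ_apply']⟩

/-- `L = ⋂ n, φⁿ(X)`. -/
def setL {X : Type*} (φ : X → X) : Set X :=
  iterInter φ univ

theorem mapsTo_setL {X : Type*} (φ : X → X) : MapsTo φ (setL φ) (setL φ) :=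
  mapsTo_iterInter (mapsTo_univ φ univ)

/-- `M = X ∖ Int L`. -/
def setM {X : Type*} [TopologicalSpace X] (φ : X → X) : Set X :=
  (interior (setL φ))ᶜ

/-- `M = M₁ ∪ M₂` is a splitting into disjoint closed `φ`-invariant sets such that
`ρ(T, C(M₁)) < |lam|` if `M₁ ≠ ∅`, and, if `M₂ ≠ ∅`, `T` is invertible on `C(N₂)`, where
`N₂ = ⋂ n, φⁿ(M₂)`, with `|lam| < 1 / ρ(T⁻¹, C(N₂))`, and `M₂ ∖ φ(M₂)` is finite. -/
structure IsSplitting {X : Type*} [TopologicalSpace X] (φ : C(X, X)) (w : C(X, ℂ)) (lam : ℂ)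
    (M₁ M₂ : Set X) : Prop where
  union_eq : M₁ ∪ M₂ = setM φ
  disjoint : Disjoint M₁ M₂
  isClosed_left : IsClosed M₁
  isClosed_right : IsClosed M₂
  mapsTo_left : MapsTo φ M₁ M₁
  mapsTo_right : MapsTo φ M₂ M₂
  radius_left : M₁.Nonempty →
    spectralRadius ℂ (weightedCompOn φ w M₁ mapsTo_left) < ENNReal.ofReal ‖lam‖
  radius_right : M₂.Nonempty →
    ∃ u : (C(iterInter φ M₂, ℂ) →L[ℂ] C(iterInter φ M₂, ℂ))ˣ,
      (u : C(iterInter φ M₂, ℂ) →L[ℂ] C(iterInter φ M₂, ℂ)) =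
        weightedCompOn φ w (iterInter φ M₂) (mapsTo_iterInter mapsTo_right) ∧
      ENNReal.ofReal ‖lam‖ < 1 / spectralRadius ℂ
        ((u⁻¹ : (C(iterInter φ M₂, ℂ) →L[ℂ] C(iterInter φ M₂, ℂ))ˣ) :
          C(iterInter φ M₂, ℂ) →L[ℂ] C(iterInter φ M₂, ℂ))
  finite_right : M₂.Nonempty → (M₂ \ φ '' M₂).Finite

open Filter Topology Function

/-! Dividing by `lam`, put `v = w / lam` and `S = 1 - T_v`. Restriction to `L` maps `C(K)` onto
`C(L)` and intertwines `S` with the same operator on `C(L)`, so everything depends on `S` acting on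
the functions that vanish on `L`, which live on `M = closure Lᶜ`.

Given a splitting, `S` maps that space onto itself (`exists_solution`). On `M₁` the equation `f - v
f∘φ = g` is solved by the resolvent, and contraction forces the solution to vanish on `M₁ ∩ L`. Off
`L`, `M₂` consists of finitely many trajectories of isolated points. Along each one the equation is
a recursion with one free value, and expansion makes all its solutions tend to `0`. Hence `ker S` is
`ker (S, C(L))` times one copy of `ℂ` per trajectory, and the range of `S` is the preimage of the
range on `C(L)`. This gives one implication, the passage of the Fredholm property to `C(L)` and the
dimension formula.

Conversely, an upper semi-Fredholm `S` satisfies `‖f‖ ≤ C ‖S f‖` for all `f` vanishing on some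
finite set `s`. Every point outside `L` lies on a unique trajectory starting outside `φ(K)`. On the
trajectories that avoid `s`, bump functions pushed backwards by `T` show that the iterated weights
decay uniformly (`mul_weightProd_le_of_estimate`). Finitely many trajectories remain. One that
enters the closure of the others inherits their decay; any other consists of isolated points, and
the estimate for sequences gives either decay or eventual growth (`uniformDecay_or_uniformGrowth`).
The closures of the decaying and of the growing trajectories form `M₁` and `M₂`. -/

/-- The iterated weight `w(x) w(φ x) ⋯ w(φⁿ⁻¹ x)`. -/
def weightProd {X : Type*} (φ : X → X) (w : X → ℂ) (n : ℕ) (x : X) : ℂ :=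
  ∏ i ∈ Finset.range n, w (φ^[i] x)

/-! ### Iterated weights -/

section WeightProd

variable {X : Type*} {φ : X → X} {w : X → ℂ}

@[simp] theorem weightProd_zero (x : X) : weightProd φ w 0 x = 1 := by simp [weightProd]

@[simp] theorem weightProd_one (x : X) : weightProd φ w 1 x = w x := by simp [weightProd]

theorem weightProd_succ (n : ℕ) (x : X) :
    weightProd φ w (n + 1) x = w x * weightProd φ w n (φ x) := by
  simp [weightProd, Finset.prod_range_succ', mul_comm]

theorem weightProd_add (m n : ℕ) (x : X) :
    weightProd φ w (m + n) x = weightProd φ w m x * weightProd φ w n (φ^[m] x) := by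
  simp only [weightProd, Finset.prod_range_add, ← iterate_add_apply, add_comm _ m]

theorem weightProd_smul (c : ℂ) (n : ℕ) (x : X) :
    weightProd φ (fun y => c * w y) n x = c ^ n * weightProd φ w n x := by
  simp [weightProd, Finset.prod_mul_distrib]

theorem continuous_weightProd [TopologicalSpace X] (hφ : Continuous φ) (hw : Continuous w)
    (n : ℕ) : Continuous (weightProd φ w n) :=
  continuous_finsetProd _ fun i _ => hw.comp (hφ.iterate i)

end WeightProd

/-! ### Powers of weighted composition operators -/

section WeightedComp

variable {X : Type*} [TopologicalSpace X] (φ : C(X, X)) (w : C(X, ℂ))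

@[simp] theorem weightedComp_apply (f : C(X, ℂ)) (x : X) :
    weightedComp φ w f x = w x * f (φ x) := rfl

theorem weightedComp_pow_apply (n : ℕ) (f : C(X, ℂ)) (x : X) :
    (weightedComp φ w ^ n) f x = weightProd φ w n x * f (φ^[n] x) := by
  induction n generalizing x with
  | zero => simp
  | succ n ih =>
    rw [pow_succ', mul_apply_eq_comp, weightedComp_apply, ih, weightProd_succ,
      iterate_succ_apply, mul_assoc]

theorem weightedCompOn_apply (A : Set X) (hA : MapsTo φ A A) (f : C(A, ℂ)) (x : A) :
    weightedCompOn φ w A hA f x = w x * f ⟨φ x, hA x.2⟩ := rfl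

theorem weightedCompOn_pow_apply (A : Set X) (hA : MapsTo φ A A) (n : ℕ) (f : C(A, ℂ)) (x : A) :
    (weightedCompOn φ w A hA ^ n) f x =
      weightProd φ w n x * f ⟨φ^[n] x, hA.iterate n x.2⟩ := by
  induction n generalizing x with
  | zero => simp
  | succ n ih =>
    rw [pow_succ', mul_apply_eq_comp, weightedCompOn_apply, ih, weightProd_succ,
      mul_assoc]
    simp only [iterate_succ_apply]

end WeightedComp

/-! ### Spectral radius bounds and norms of powers -/

section SpectralRadius

variable {A : Type*} [NormedRing A] [NormedAlgebra ℂ A] [CompleteSpace A]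

theorem spectralRadius_lt_of_norm_pow_lt [NormOneClass A] {a : A} {c : ℝ} (hc : 0 ≤ c) {n : ℕ}
    (hn : n ≠ 0) (h : ‖a ^ n‖ < c ^ n) : spectralRadius ℂ a < ENNReal.ofReal c := by
  obtain ⟨m, rfl⟩ := Nat.exists_eq_succ_of_ne_zero hn
  refine (spectrum.spectralRadius_le_pow_nnnorm_pow_one_div ℂ a m).trans_lt ?_
  have h1 : (‖(1 : A)‖₊ : ENNReal) ^ (1 / (m + 1) : ℝ) = 1 := by simp
  rw [h1, mul_one]
  have h2 : (‖a ^ (m + 1)‖₊ : ENNReal) < ENNReal.ofReal c ^ (m + 1) := by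
    rw [← ENNReal.ofReal_pow hc, ← enorm_eq_nnnorm, ← ofReal_norm]
    exact (ENNReal.ofReal_lt_ofReal_iff_of_nonneg (norm_nonneg _)).2 h
  have h3 : (0 : ℝ) < 1 / (m + 1) := by positivity
  refine (ENNReal.rpow_lt_rpow h2 h3).trans_eq ?_
  rw [← ENNReal.rpow_natCast, ← ENNReal.rpow_mul]
  have : ((m + 1 : ℕ) : ℝ) * (1 / (m + 1)) = 1 := by push_cast; field_simp
  rw [this, ENNReal.rpow_one]

/-- Gelfand's formula: `‖aⁿ‖^(1/n)` converges to the spectral radius, so it is eventually below `c`.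
-/
theorem exists_norm_pow_lt_of_spectralRadius_lt {a : A} {c : ℝ} (hc : 0 ≤ c)
    (h : spectralRadius ℂ a < ENNReal.ofReal c) : ∃ n : ℕ, n ≠ 0 ∧ ‖a ^ n‖ < c ^ n := by
  have h1 := (spectrum.pow_nnnorm_pow_one_div_tendsto_nhds_spectralRadius a).eventually_lt_const h
  obtain ⟨n, hn, hn0⟩ := (h1.and (eventually_gt_atTop 0)).exists
  refine ⟨n, hn0.ne', ?_⟩
  have h3 : (0 : ℝ) < n := by exact_mod_cast hn0
  have h2 := ENNReal.rpow_lt_rpow hn h3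
  rw [← ENNReal.rpow_mul, one_div_mul_cancel h3.ne', ENNReal.rpow_one, ENNReal.rpow_natCast,
    ← ENNReal.ofReal_pow hc, ← enorm_eq_nnnorm, ← ofReal_norm] at h2
  exact (ENNReal.ofReal_lt_ofReal_iff_of_nonneg (norm_nonneg _)).1 h2

theorem ofReal_lt_one_div_iff {c : ℝ} (hc : 0 < c) (r : ENNReal) :
    ENNReal.ofReal c < 1 / r ↔ r < ENNReal.ofReal c⁻¹ := by
  rw [one_div, ENNReal.lt_inv_iff_lt_inv, ENNReal.ofReal_inv_of_pos hc]

theorem exists_norm_pow_lt_of_spectralRadius_lt_continuousMap {X : Type*} [TopologicalSpace X]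
    [CompactSpace X] (T : C(X, ℂ) →L[ℂ] C(X, ℂ)) {c : ℝ} (hc : 0 ≤ c)
    (h : spectralRadius ℂ T < ENNReal.ofReal c) : ∃ n : ℕ, n ≠ 0 ∧ ‖T ^ n‖ < c ^ n :=
  exists_norm_pow_lt_of_spectralRadius_lt (A := C(X, ℂ) →L[ℂ] C(X, ℂ)) (a := T) hc h

theorem spectralRadius_lt_of_norm_pow_lt_continuousMap {X : Type*} [TopologicalSpace X]
    [CompactSpace X] [Nonempty X] (T : C(X, ℂ) →L[ℂ] C(X, ℂ)) {c : ℝ} (hc : 0 ≤ c) {n : ℕ}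
    (hn : n ≠ 0) (h : ‖T ^ n‖ < c ^ n) : spectralRadius ℂ T < ENNReal.ofReal c :=
  spectralRadius_lt_of_norm_pow_lt (A := C(X, ℂ) →L[ℂ] C(X, ℂ)) (a := T) hc hn h

end SpectralRadius

/-! ### Trajectories and the sets `⋂ φⁿ(A)` -/

section Trajectories

variable {X : Type*} {φ : X → X}

/-- Pull `x` back as often as possible: one step less than the first `n` with `x ∉ φⁿ(A)`. -/
theorem exists_iterate_of_notMem_iterInter {A : Set X} {x : X} (hx : x ∈ A)
    (h : x ∉ iterInter φ A) : ∃ p ∈ A \ φ '' A, ∃ n, φ^[n] p = x := by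
  simp only [iterInter, mem_iInter, not_forall] at h
  classical
  have h0 : Nat.find h ≠ 0 := fun h0 => Nat.find_spec h (by rw [h0]; simpa using hx)
  obtain ⟨k, hk⟩ := Nat.exists_eq_succ_of_ne_zero h0
  have h1 : x ∈ φ^[k] '' A := not_not.1 (Nat.find_min h (by omega))
  obtain ⟨p, hp, rfl⟩ := h1
  refine ⟨p, ⟨hp, ?_⟩, k, rfl⟩
  rintro ⟨q, hq, rfl⟩
  exact Nat.find_spec h (by rw [hk]; exact ⟨q, hq, rfl⟩)

theorem iterate_notMem_image_succ (hφ : Injective φ) {A : Set X} {p : X} (hp : p ∉ φ '' A)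
    (n : ℕ) : φ^[n] p ∉ φ^[n + 1] '' A := by
  rintro ⟨q, hq, h⟩
  rw [iterate_succ_apply] at h
  exact hp ⟨q, hq, hφ.iterate n h⟩

/-- After cancelling the common iterates, any surplus iterate would put a starting point into
`φ(A)`. Thus trajectories starting in `A \ φ(A)` are disjoint and never repeat a point. -/
theorem iterate_inj_of_notMem_image (hφ : Injective φ) {A : Set X} (hA : MapsTo φ A A) {p q : X}
    (hp : p ∈ A \ φ '' A) (hq : q ∈ A \ φ '' A) {m n : ℕ} (h : φ^[m] p = φ^[n] q) :
    p = q ∧ m = n := by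
  wlog hmn : m ≤ n generalizing p q m n
  · have := this hq hp h.symm (by omega)
    exact ⟨this.1.symm, this.2.symm⟩
  obtain ⟨k, rfl⟩ := Nat.exists_eq_add_of_le hmn
  rw [iterate_add_apply] at h
  have h := hφ.iterate m h
  rcases k with _ | k
  · exact ⟨h, rfl⟩
  · refine absurd ⟨φ^[k] q, hA.iterate k hq.1, ?_⟩ hp.2
    rw [h, iterate_succ_apply']

theorem antitone_image_iterate {A : Set X} (hA : MapsTo φ A A) :
    Antitone fun n : ℕ => φ^[n] '' A := by
  refine antitone_nat_of_succ_le fun n => ?_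
  rintro _ ⟨a, ha, rfl⟩
  exact ⟨φ a, hA ha, (iterate_succ_apply _ _ _).symm⟩

theorem iterInter_mono {A B : Set X} (h : A ⊆ B) : iterInter φ A ⊆ iterInter φ B :=
  iInter_mono fun _ => image_mono h

theorem iterInter_subset (A : Set X) : iterInter φ A ⊆ A :=
  (iInter_subset _ 0).trans (by simp)

/-- An injective map carries `⋂ φⁿ(A)` onto itself. -/
theorem exists_preimage_mem_iterInter (hφ : Injective φ) {A : Set X} {x : X}
    (hx : x ∈ iterInter φ A) : ∃ y ∈ iterInter φ A, φ y = x := by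
  obtain ⟨y, hy, rfl⟩ := mem_iInter.1 hx 1
  refine ⟨y, mem_iInter.2 fun n => ?_, rfl⟩
  obtain ⟨z, hz, h⟩ := mem_iInter.1 hx (n + 1)
  exact ⟨z, hz, hφ ((iterate_succ_apply' φ n z).symm.trans h)⟩

theorem setM_eq [TopologicalSpace X] (φ : X → X) : setM φ = closure (setL φ)ᶜ := by
  rw [setM, closure_compl]

variable [TopologicalSpace X] [CompactSpace X] [T2Space X]

theorem isClosed_iterInter (hφ : Continuous φ) {A : Set X} (hA : IsClosed A) :
    IsClosed (iterInter φ A) :=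
  isClosed_iInter fun n => (hA.isCompact.image (hφ.iterate n)).isClosed

theorem exists_image_iterate_subset (hφ : Continuous φ) {A : Set X} (hA : IsClosed A)
    (hAφ : MapsTo φ A A) {U : Set X} (hU : IsOpen U) (h : iterInter φ A ⊆ U) :
    ∃ n : ℕ, φ^[n] '' A ⊆ U :=
  exists_subset_nhds_of_isCompact (antitone_image_iterate hAφ).directed_ge
    (fun n => hA.isCompact.image (hφ.iterate n)) fun _ hx => hU.mem_nhds (h hx)

end Trajectories

/-! ### Constructing continuous functions by gluing -/

section Gluing

variable {X : Type*} [TopologicalSpace X]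

/-- Extension by zero of a continuous function on a closed set. -/
theorem exists_extension_by_zero {A B : Set X} (hA : IsClosed A) (hB : IsClosed B)
    (hAB : A ∪ B = univ) (f : C(A, ℂ)) (hf : ∀ x : A, (x : X) ∈ B → f x = 0) :
    ∃ h : C(X, ℂ), (∀ x : A, h x = f x) ∧ ∀ x ∈ B, h x = 0 := by
  classical
  set h : X → ℂ := fun x => if hx : x ∈ A then f ⟨x, hx⟩ else 0 with h_def
  have h1 : ∀ x : A, h x = f x := fun x => by simp [h_def]
  have h2 : ∀ x ∈ B, h x = 0 := fun x hx => by
    by_cases hxA : x ∈ A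
    · simp only [h_def, hxA, dif_pos]; exact hf _ hx
    · simp [h_def, hxA]
  have hc : Continuous h := by
    rw [← continuousOn_univ, ← hAB]
    refine ContinuousOn.union_of_isClosed ?_ ?_ hA hB
    · rw [continuousOn_iff_continuous_domRestrict]
      convert f.continuous using 1
      ext x
      exact h1 x
    · exact continuousOn_const.congr h2
  exact ⟨⟨h, hc⟩, h1, h2⟩

/-- A null family of values at isolated points is interpolated by a continuous function which
vanishes elsewhere. -/
theorem exists_continuousMap_of_null [T1Space X] {ι : Type*} {p : ι → X} (hp : Injective p)
    (hpo : ∀ i, IsOpen {p i}) (a : ι → ℂ) (ha : ∀ ε > 0, {i | ε ≤ ‖a i‖}.Finite) :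
    ∃ f : C(X, ℂ), (∀ i, f (p i) = a i) ∧ ∀ x ∉ range p, f x = 0 := by
  refine ⟨⟨extend p a 0, continuous_iff_continuousAt.2 fun x => ?_⟩, fun i => hp.extend_apply _ _ _,
    fun x hx => extend_apply' _ _ _ hx⟩
  by_cases hx : x ∈ range p
  · obtain ⟨i, rfl⟩ := hx
    rw [ContinuousAt, (isOpen_singleton_iff_nhds_eq_pure _).1 (hpo i)]
    exact tendsto_pure_nhds _ _
  · rw [Metric.continuousAt_iff']
    intro ε hε
    have hfin := ((ha ε hε).image p).isClosed
    have hmem : x ∈ (p '' {i | ε ≤ ‖a i‖})ᶜ := fun ⟨i, _, hi⟩ => hx ⟨i, hi⟩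
    filter_upwards [hfin.isOpen_compl.mem_nhds hmem] with y hy
    rw [extend_apply' _ _ x hx, Pi.zero_apply, dist_zero_right]
    by_cases hy' : y ∈ range p
    · obtain ⟨i, rfl⟩ := hy'
      rw [hp.extend_apply]
      by_contra h
      exact hy ⟨i, not_lt.1 h, rfl⟩
    · rw [extend_apply' _ _ y hy']
      simpa using hε

end Gluing

/-! ### The recursion along one trajectory -/

section Sequences

/-- The value is prescribed at `N`: beyond `N` one divides by the nonzero weights, while below `N`
the recursion itself gives the values, even where weights vanish. -/
theorem exists_backward_recursion (w g : ℕ → ℂ) (N : ℕ) (hw : ∀ j ≥ N, w j ≠ 0) (c : ℂ) :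
    ∃ f : ℕ → ℂ, f N = c ∧ ∀ j, f j = g j + w j * f (j + 1) := by
  induction N generalizing w g with
  | zero =>
    refine ⟨fun j => Nat.rec c (fun i y => (y - g i) / w i) j, rfl, fun j => ?_⟩
    have := hw j (Nat.zero_le j)
    field_simp
    ring
  | succ N ih =>
    obtain ⟨f, hf, hrec⟩ := ih (fun j => w (j + 1)) (fun j => g (j + 1))
      fun j hj => hw _ (by omega)
    refine ⟨fun j => Nat.casesOn j (g 0 + w 0 * f 0) f, hf, fun j => ?_⟩
    rcases j with _ | j
    · rfl
    · exact hrec j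

theorem eq_zero_of_backward_recursion {w f : ℕ → ℂ} {N : ℕ} (hw : ∀ j ≥ N, w j ≠ 0)
    (hf : ∀ j, f j = w j * f (j + 1)) (h0 : f N = 0) (j : ℕ) : f j = 0 := by
  rcases le_total N j with h | h
  · induction j, h using Nat.le_induction with
    | base => exact h0
    | succ j hj ih =>
      rw [hf j] at ih
      exact (mul_eq_zero.1 ih).resolve_left (hw j hj)
  · induction h using Nat.decreasingInduction with
    | self => exact h0
    | of_succ j _ ih => rw [hf j, ih, mul_zero]

theorem tendsto_zero_of_contraction {a b : ℕ → ℝ} {n N : ℕ} (hn : n ≠ 0) {c : ℝ} (hc0 : 0 ≤ c)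
    (hc : c < 1) (ha : ∀ j, 0 ≤ a j) (hb : Tendsto b atTop (𝓝 0))
    (h : ∀ j ≥ N, a (j + n) ≤ c * a j + b j) : Tendsto a atTop (𝓝 0) := by
  rw [Metric.tendsto_atTop]
  intro ε hε
  have hε' : 0 < ε / 2 * (1 - c) := mul_pos (by linarith) (by linarith)
  obtain ⟨N₁, hN₁⟩ := (hb.eventually_lt_const hε').exists_forall_of_atTop
  set N₂ := max N N₁ with hN₂
  set A := ∑ r ∈ Finset.range n, a (N₂ + r) with hA
  -- Iterate within each residue class modulo `n`; `A` bounds all the `n` starting values at once.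
  have key : ∀ k r, r < n → a (N₂ + r + k * n) ≤ ε / 2 + c ^ k * A := by
    intro k r hr
    induction k with
    | zero =>
      have : a (N₂ + r) ≤ A :=
        Finset.single_le_sum (f := fun r => a (N₂ + r)) (fun i _ => ha _) (Finset.mem_range.2 hr)
      simp only [zero_mul, add_zero, pow_zero, one_mul]
      linarith
    | succ k ih =>
      have h1 := h (N₂ + r + k * n) (by have := le_max_left N N₁; omega)
      have h2 := hN₁ (N₂ + r + k * n) (by have := le_max_right N N₁; omega)
      have h3 := mul_le_mul_of_nonneg_left ih hc0
      have h4 : N₂ + r + (k + 1) * n = N₂ + r + k * n + n := by ring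
      rw [h4, pow_succ]
      nlinarith
  have hlim : Tendsto (fun k : ℕ => c ^ k * A) atTop (𝓝 0) := by
    simpa using (tendsto_pow_atTop_nhds_zero_of_lt_one hc0 hc).mul_const A
  obtain ⟨k₀, hk₀⟩ := (hlim.eventually_lt_const (half_pos hε)).exists_forall_of_atTop
  refine ⟨N₂ + k₀ * n, fun j hj => ?_⟩
  rw [Real.dist_eq, sub_zero, abs_of_nonneg (ha j)]
  have h1 := key ((j - N₂) / n) ((j - N₂) % n) (Nat.mod_lt _ (by omega))
  have h2 : N₂ + (j - N₂) % n + (j - N₂) / n * n = j := by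
    have := Nat.mod_add_div' (j - N₂) n
    omega
  rw [h2] at h1
  have h3 := hk₀ ((j - N₂) / n) ((Nat.le_div_iff_mul_le (by omega)).2 (by omega))
  linarith

/-- Solutions of `f(j) = g(j) + w(j) f(j+1)` with `g` null are null if the weight is expanding. -/
theorem tendsto_zero_of_backward_recursion {w g f : ℕ → ℂ} {n N : ℕ} {q A : ℝ} (hq : 1 < q)
    (hA : ∀ j, ‖w j‖ ≤ A) (hw : ∀ j ≥ N, q ≤ ‖weightProd Nat.succ w n j‖)
    (hg : Tendsto g atTop (𝓝 0)) (hf : ∀ j, f j = g j + w j * f (j + 1)) :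
    Tendsto f atTop (𝓝 0) := by
  have hn : n ≠ 0 := by
    rintro rfl
    have := hw N le_rfl
    simp at this
    linarith
  have hA0 : 0 ≤ A := (norm_nonneg _).trans (hA 0)
  have hbd : ∀ i j, ‖weightProd Nat.succ w i j‖ ≤ A ^ i := fun i j => by
    rw [weightProd, norm_prod]
    exact (Finset.prod_le_prod (fun _ _ => norm_nonneg _) fun k _ => hA _).trans_eq (by simp)
  have hexp : ∀ m j, f j = ∑ i ∈ Finset.range m, weightProd Nat.succ w i j * g (j + i) +
      weightProd Nat.succ w m j * f (j + m) := by
    intro m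
    induction m with
    | zero => simp
    | succ m ih =>
      intro j
      rw [Finset.sum_range_succ, ih j, hf (j + m), weightProd_add]
      simp [Nat.succ_iterate]
      ring_nf
  rw [tendsto_zero_iff_norm_tendsto_zero]
  -- Expansion by `q` over `n` steps becomes contraction by `q⁻¹` when the recursion is solved for
  -- `f (j + n)`.
  refine tendsto_zero_of_contraction (N := N) (c := q⁻¹)
    (b := fun j => q⁻¹ * ∑ i ∈ Finset.range n, A ^ i * ‖g (j + i)‖) hn (by positivity)
    (inv_lt_one_of_one_lt₀ hq) (fun _ => norm_nonneg _) ?_ fun j hj => ?_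
  · have : Tendsto (fun j => q⁻¹ * ∑ i ∈ Finset.range n, A ^ i * ‖g (j + i)‖) atTop
        (𝓝 (q⁻¹ * ∑ i ∈ Finset.range n, A ^ i * 0)) := by
      refine (tendsto_finsetSum _ fun i _ => ?_).const_mul _
      have := ((tendsto_add_atTop_iff_nat i).2 hg).norm
      rw [norm_zero] at this
      exact this.const_mul _
    simpa using this
  · have h1 : weightProd Nat.succ w n j * f (j + n) =
        f j - ∑ i ∈ Finset.range n, weightProd Nat.succ w i j * g (j + i) := by
      rw [hexp n j]; ring
    have h2 : q * ‖f (j + n)‖ ≤ ‖f j‖ + ∑ i ∈ Finset.range n, A ^ i * ‖g (j + i)‖ := by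
      calc q * ‖f (j + n)‖ ≤ ‖weightProd Nat.succ w n j‖ * ‖f (j + n)‖ := by
            gcongr; exact hw j hj
        _ ≤ _ := by
            rw [← norm_mul, h1]
            refine (norm_sub_le _ _).trans ?_
            gcongr
            refine norm_sum_le_of_le _ fun i _ => ?_
            rw [norm_mul]
            gcongr
            exact hbd i j
    rw [← mul_add, inv_mul_eq_div, le_div_iff₀ (by linarith)]
    linarith

end Sequences

/-! ### Solving the equation on functions vanishing on `L` -/

section Splitting

variable {X : Type*} [TopologicalSpace X]

theorem eq_weightProd_mul {X : Type*} {φ : X → X} {v f : X → ℂ} {A : Set X} (hA : MapsTo φ A A)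
    (h : ∀ x ∈ A, f x = v x * f (φ x)) (n : ℕ) :
    ∀ x ∈ A, f x = weightProd φ v n x * f (φ^[n] x) := by
  induction n with
  | zero => simp
  | succ n ih =>
    intro x hx
    rw [weightProd_succ, iterate_succ_apply, mul_assoc, ← ih _ (hA hx), h x hx]

/-- At a point of `A` where `‖f‖` is maximal, `n` iterations give `‖f‖ ≤ θ ‖f‖` with `θ < 1`. -/
theorem eq_zero_of_weightProd_lt {φ : X → X} {v f : X → ℂ} {A : Set X} (hA : MapsTo φ A A)
    (hAc : IsCompact A) (hf : ContinuousOn f A) (h : ∀ x ∈ A, f x = v x * f (φ x)) {n : ℕ}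
    (hn : ∀ x ∈ A, ‖weightProd φ v n x‖ < 1) : ∀ x ∈ A, f x = 0 := by
  intro x hx
  obtain ⟨y, hy, hmax⟩ := hAc.exists_isMaxOn ⟨x, hx⟩ hf.norm
  have h1 : ‖f y‖ ≤ ‖weightProd φ v n y‖ * ‖f y‖ := by
    conv_lhs => rw [eq_weightProd_mul hA h n y hy, norm_mul]
    exact mul_le_mul_of_nonneg_left (hmax (hA.iterate n hy)) (norm_nonneg _)
  have h2 : ‖f y‖ = 0 := by nlinarith [hn y hy, norm_nonneg (f y)]
  exact norm_le_zero_iff.1 ((hmax hx).trans h2.le)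

/-- A splitting of `M` into a part on which the iterated weights contract and on which the
equation `f - v f∘φ = g` is solvable, and a part with finitely many trajectories on which the
weights expand. -/
structure HyperbolicSplitting (φ : C(X, X)) (v : C(X, ℂ)) (M₁ M₂ : Set X) : Prop where
  union_eq : M₁ ∪ M₂ = setM φ
  disjoint : Disjoint M₁ M₂
  isClosed_left : IsClosed M₁
  isClosed_right : IsClosed M₂
  mapsTo_left : MapsTo φ M₁ M₁
  mapsTo_right : MapsTo φ M₂ M₂
  solvable : ∀ g : C(X, ℂ), ∃ f : C(X, ℂ), ∀ x ∈ M₁, f x - v x * f (φ x) = g x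
  contracting : ∃ n, ∀ x ∈ M₁, ‖weightProd φ v n x‖ < 1
  expanding : ∃ n, ∀ x ∈ iterInter φ M₂, 1 < ‖weightProd φ v n x‖
  finite : (M₂ \ φ '' M₂).Finite

namespace HyperbolicSplitting

variable {φ : C(X, X)} {v : C(X, ℂ)} {M₁ M₂ : Set X}

theorem finite_diff (h : HyperbolicSplitting φ v M₁ M₂) (n : ℕ) :
    (M₂ \ φ^[n] '' M₂).Finite := by
  induction n with
  | zero => simp
  | succ n ih =>
    refine (h.finite.union (ih.image φ)).subset ?_
    rintro x ⟨hx, hx'⟩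
    by_cases hx1 : x ∈ φ '' M₂
    · obtain ⟨y, hy, rfl⟩ := hx1
      refine Or.inr ⟨y, ⟨hy, ?_⟩, rfl⟩
      rintro ⟨z, hz, rfl⟩
      exact hx' ⟨z, hz, iterate_succ_apply' _ _ _⟩
    · exact Or.inl ⟨hx, hx1⟩

theorem exists_iterate {x : X} (hx : x ∈ M₂)
    (hxL : x ∉ setL φ) : ∃ p ∈ M₂ \ φ '' M₂, ∃ n, φ^[n] p = x :=
  exists_iterate_of_notMem_iterInter hx fun h1 => hxL (iterInter_mono (subset_univ _) h1)

theorem weightProd_trajectory {X : Type*} (φ : X → X) (v : X → ℂ) (p : X) (n j : ℕ) :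
    weightProd Nat.succ (fun i => v (φ^[i] p)) n j = weightProd φ v n (φ^[j] p) := by
  simp only [weightProd, Nat.succ_iterate, ← iterate_add_apply, add_comm]

theorem ne_zero_of_expanding {X : Type*} {φ : X → X} {v : X → ℂ} {n : ℕ} {q : ℝ} (hq : 1 < q)
    {x : X} (hx : q ≤ ‖weightProd φ v n x‖) : v x ≠ 0 := by
  intro h0
  rcases n with _ | n
  · simp at hx; linarith
  · rw [weightProd_succ, h0] at hx
    simp at hx
    linarith

theorem eq_zero_of_fixed [CompactSpace X] (h : HyperbolicSplitting φ v M₁ M₂) {n N : ℕ} {q : ℝ}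
    (hq : 1 < q) (hN : ∀ x ∈ φ^[N] '' M₂, q ≤ ‖weightProd φ v n x‖) {f : C(X, ℂ)}
    (hf0 : ∀ x ∈ setL φ, f x = 0) (hf : ∀ x, f x = v x * f (φ x))
    (hfN : ∀ p ∈ M₂ \ φ '' M₂, f (φ^[N] p) = 0) : f = 0 := by
  obtain ⟨m, hm⟩ := h.contracting
  ext x
  by_cases hx : x ∈ setL φ
  · exact hf0 x hx
  have hxM : x ∈ setM φ := by rw [setM_eq]; exact subset_closure hx
  rw [← h.union_eq] at hxM
  rcases hxM with hx1 | hx2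
  · exact eq_zero_of_weightProd_lt h.mapsTo_left h.isClosed_left.isCompact
      f.continuous.continuousOn (fun x _ => hf x) hm x hx1
  · obtain ⟨p, hp, j, rfl⟩ := exists_iterate hx2 hx
    refine eq_zero_of_backward_recursion (w := fun j => v (φ^[j] p)) (f := fun j => f (φ^[j] p))
      (N := N) (fun j hj => ?_) (fun j => ?_) (hfN p hp) j
    · exact ne_zero_of_expanding hq
        (hN _ (antitone_image_iterate h.mapsTo_right hj ⟨p, hp.1, rfl⟩))
    · simp only [iterate_succ_apply']
      exact hf _

variable [CompactSpace X] [T2Space X]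

theorem isClosed_setL (φ : C(X, X)) : IsClosed (setL φ) :=
  isClosed_iterInter φ.continuous isClosed_univ

/-- Removing `M₁`, `φⁿ(M₂)` and the finitely many other points of `M₂ \ φⁿ(M₂)` leaves a
neighbourhood of `x` that meets `M` only in `x`. Since `M` is the closure of `Lᶜ`, this
neighbourhood meets `Lᶜ`, necessarily in `x` alone. -/
theorem isolated (h : HyperbolicSplitting φ v M₁ M₂) {x : X} {n : ℕ} (hx : x ∈ M₂)
    (hxn : x ∉ φ^[n] '' M₂) : IsOpen {x} ∧ x ∉ setL φ := by
  set E := (M₂ \ φ^[n] '' M₂) \ {x} with hE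
  set V := (φ^[n] '' M₂)ᶜ ∩ M₁ᶜ ∩ Eᶜ with hV
  have hEf : E.Finite := (h.finite_diff n).subset sdiff_subset
  have hVo : IsOpen V :=
    ((h.isClosed_right.isCompact.image (φ.continuous.iterate n)).isClosed.isOpen_compl.inter
      h.isClosed_left.isOpen_compl).inter hEf.isClosed.isOpen_compl
  have hxV : x ∈ V := ⟨⟨hxn, fun h1 => h.disjoint.notMem_of_mem_left h1 hx⟩, fun h1 => h1.2 rfl⟩
  have hVM : ∀ y ∈ V, y ∈ setM φ → y = x := by
    intro y hy hyM
    rw [← h.union_eq] at hyM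
    by_contra hne
    exact hy.2 ⟨⟨hyM.resolve_left hy.1.2, hy.1.1⟩, hne⟩
  have hVL : ∀ y ∈ V ∩ (setL φ)ᶜ, y = x := fun y hy =>
    hVM y hy.1 (by rw [setM_eq]; exact subset_closure hy.2)
  have hxM : x ∈ closure (setL φ)ᶜ := by rw [← setM_eq, ← h.union_eq]; exact Or.inr hx
  obtain ⟨y, hy⟩ := mem_closure_iff.1 hxM V hVo hxV
  have hxL : x ∉ setL φ := by rw [← hVL y hy]; exact hy.2
  refine ⟨?_, hxL⟩
  have : {x} = V ∩ (setL φ)ᶜ := by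
    ext z
    exact ⟨fun hz => by rw [mem_singleton_iff.1 hz]; exact ⟨hxV, hxL⟩, hVL z⟩
  rw [this]
  exact hVo.inter (isClosed_setL φ).isOpen_compl

theorem isolated_iterate (h : HyperbolicSplitting φ v M₁ M₂) (hφ : Injective φ) {p : X}
    (hp : p ∈ M₂ \ φ '' M₂) (n : ℕ) : IsOpen {φ^[n] p} ∧ φ^[n] p ∉ setL φ :=
  h.isolated (h.mapsTo_right.iterate n hp.1) (iterate_notMem_image_succ hφ hp.2 n)

/-- Expansion is assumed only on `⋂ φⁿ(M₂)`; by compactness it already holds on some `φ^N(M₂)`, with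
a uniform constant. This `N` is where the free values along trajectories are placed. -/
theorem exists_expanding_image (h : HyperbolicSplitting φ v M₁ M₂) :
    ∃ (n N : ℕ) (q : ℝ), 1 < q ∧ ∀ x ∈ φ^[N] '' M₂, q ≤ ‖weightProd φ v n x‖ := by
  obtain ⟨n, hn⟩ := h.expanding
  have hc : Continuous fun x => ‖weightProd φ v n x‖ :=
    (continuous_weightProd φ.continuous v.continuous n).norm
  obtain ⟨N, hN⟩ := exists_image_iterate_subset φ.continuous h.isClosed_right h.mapsTo_right
    (isOpen_lt continuous_const hc) hn
  rcases (φ^[N] '' M₂).eq_empty_or_nonempty with he | hne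
  · exact ⟨n, N, 2, one_lt_two, by simp [he]⟩
  · obtain ⟨y, hy, hmin⟩ := (h.isClosed_right.isCompact.image
      (φ.continuous.iterate N)).exists_isMinOn hne hc.continuousOn
    exact ⟨n, N, _, hN hy, fun x hx => hmin hx⟩

theorem tendsto_iterate (h : HyperbolicSplitting φ v M₁ M₂) {g : C(X, ℂ)}
    (hg : ∀ x ∈ setL φ, g x = 0) {p : X} (hp : p ∈ M₂) :
    Tendsto (fun j : ℕ => g (φ^[j] p)) atTop (𝓝 0) := by
  rw [Metric.tendsto_atTop]
  intro ε hε
  obtain ⟨N, hN⟩ := exists_image_iterate_subset φ.continuous h.isClosed_right h.mapsTo_right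
    (isOpen_lt g.continuous.norm continuous_const) (U := {x | ‖g x‖ < ε}) fun x hx => by
      simpa [hg x (iterInter_mono (subset_univ _) hx)] using hε
  refine ⟨N, fun j hj => ?_⟩
  rw [dist_zero_right]
  exact hN (antitone_image_iterate h.mapsTo_right hj ⟨p, hp, rfl⟩)

/-- On functions vanishing on `L`, the equation `f - T f = g` is solvable with prescribed values
at one point of each trajectory in `M₂`. -/
theorem exists_solution (h : HyperbolicSplitting φ v M₁ M₂) (hφ : Injective φ) {n N : ℕ} {q : ℝ}
    (hq : 1 < q) (hN : ∀ x ∈ φ^[N] '' M₂, q ≤ ‖weightProd φ v n x‖) {g : C(X, ℂ)}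
    (hg : ∀ x ∈ setL φ, g x = 0) (c : X → ℂ) :
    ∃ f : C(X, ℂ), (∀ x ∈ setL φ, f x = 0) ∧ (∀ x, f x - v x * f (φ x) = g x) ∧
      ∀ p ∈ M₂ \ φ '' M₂, f (φ^[N] p) = c p := by
  have hLφ := mapsTo_setL φ
  obtain ⟨h₁, hh₁⟩ := h.solvable g
  obtain ⟨m, hm⟩ := h.contracting
  -- There `g` vanishes, so `h₁` solves the homogeneous equation with contracting weights; this
  -- permits extension by zero across `L`.
  have hh₁0 : ∀ x ∈ M₁ ∩ setL φ, h₁ x = 0 := by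
    refine eq_zero_of_weightProd_lt (φ := φ) (v := v) (n := m)
      (fun x hx => ⟨h.mapsTo_left hx.1, hLφ hx.2⟩)
      (h.isClosed_left.inter (isClosed_setL φ)).isCompact h₁.continuous.continuousOn
      (fun x hx => ?_) fun x hx => hm x hx.1
    have := hh₁ x hx.1
    rw [hg x hx.2] at this
    exact sub_eq_zero.1 this
  have hM : ∀ x ∉ setL φ, x ∈ M₁ ∨ x ∈ M₂ := fun x hx => by
    have : x ∈ setM φ := by rw [setM_eq]; exact subset_closure hx
    rwa [← h.union_eq] at this
  obtain ⟨f₁, hf₁, hf₁0⟩ := exists_extension_by_zero h.isClosed_left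
    ((isClosed_setL φ).union h.isClosed_right)
    (eq_univ_of_forall fun x => by by_cases hx : x ∈ setL φ <;> simp [hx, hM]) (h₁.restrict M₁) (by
      rintro ⟨x, hx⟩ (hxL | hx2)
      · exact hh₁0 x ⟨hx, hxL⟩
      · exact absurd hx2 (h.disjoint.notMem_of_mem_left hx))
  have hseq : ∀ p : ↥(M₂ \ φ '' M₂), ∃ f : ℕ → ℂ, f N = c p ∧
      (∀ j, f j = g (φ^[j] p) + v (φ^[j] p) * f (j + 1)) ∧ Tendsto f atTop (𝓝 0) := by
    intro p
    have hexp : ∀ j ≥ N, q ≤ ‖weightProd φ v n (φ^[j] p)‖ := fun j hj =>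
      hN _ (antitone_image_iterate h.mapsTo_right hj ⟨p, p.2.1, rfl⟩)
    obtain ⟨f, hf, hrec⟩ := exists_backward_recursion (fun j => v (φ^[j] p))
      (fun j => g (φ^[j] p)) N (fun j hj => ne_zero_of_expanding hq (hexp j hj)) (c p)
    refine ⟨f, hf, hrec, tendsto_zero_of_backward_recursion (n := n) (N := N) hq
      (fun j => v.norm_coe_le_norm _) (fun j hj => ?_) (h.tendsto_iterate hg p.2.1) hrec⟩
    rw [weightProd_trajectory]
    exact hexp j hj
  choose F hFN hFrec hFlim using hseq
  -- Distinct pairs label distinct isolated points, so the null sequences `F p` assemble into one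
  -- continuous function.
  have hpinj : Injective fun i : ↥(M₂ \ φ '' M₂) × ℕ => φ^[i.2] (i.1 : X) := by
    rintro ⟨p, m⟩ ⟨p', m'⟩ heq
    obtain ⟨h1, h2⟩ := iterate_inj_of_notMem_image hφ h.mapsTo_right p.2 p'.2 heq
    exact Prod.ext (Subtype.ext h1) h2
  have := h.finite.to_subtype
  obtain ⟨f₂, hf₂, hf₂0⟩ := exists_continuousMap_of_null hpinj
    (fun i => (h.isolated_iterate hφ i.1.2 i.2).1) (fun i => F i.1 i.2) (by
      intro ε hε
      have hev : ∀ᶠ j in atTop, ∀ p, ‖F p j‖ < ε := eventually_all.2 fun p =>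
        (hFlim p).norm.eventually_lt_const (by simpa using hε)
      obtain ⟨J, hJ⟩ := hev.exists_forall_of_atTop
      refine ((finite_univ (α := ↥(M₂ \ φ '' M₂))).prod (finite_lt_nat J)).subset ?_
      rintro ⟨p, j⟩ hpj
      refine ⟨mem_univ _, not_le.1 (fun hj : J ≤ j => ?_)⟩
      exact absurd (hJ j hj p) (not_lt.2 hpj))
  have hf₂L : ∀ x ∈ setL φ, f₂ x = 0 := fun x hx => hf₂0 x (by
    rintro ⟨i, rfl⟩
    exact (h.isolated_iterate hφ i.1.2 i.2).2 hx)
  have hf₂1 : ∀ x ∈ M₁, f₂ x = 0 := fun x hx => hf₂0 x (by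
    rintro ⟨i, rfl⟩
    exact h.disjoint.notMem_of_mem_left hx (h.mapsTo_right.iterate i.2 i.1.2.1))
  refine ⟨f₁ + f₂, fun x hx => ?_, fun x => ?_, fun p hp => ?_⟩
  · simp [hf₁0 x (Or.inl hx), hf₂L x hx]
  · by_cases hx : x ∈ setL φ
    · simp [hf₁0 x (Or.inl hx), hf₂L x hx, hf₁0 _ (Or.inl (hLφ hx)), hf₂L _ (hLφ hx), hg x hx]
    · rcases hM x hx with hx1 | hx2
      · have h1 := hf₁ ⟨x, hx1⟩
        have h2 := hf₁ ⟨φ x, h.mapsTo_left hx1⟩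
        simp only [ContinuousMap.restrict_apply] at h1 h2
        simp [hf₂1 x hx1, hf₂1 _ (h.mapsTo_left hx1), h1, h2, hh₁ x hx1]
      · obtain ⟨p, hp, j, rfl⟩ := exists_iterate hx2 hx
        have h1 := hf₂ (⟨p, hp⟩, j)
        have h2 := hf₂ (⟨p, hp⟩, j + 1)
        simp only [iterate_succ_apply'] at h1 h2
        simp [hf₁0 _ (Or.inr hx2), hf₁0 _ (Or.inr (h.mapsTo_right hx2)), h1, h2,
          hFrec ⟨p, hp⟩ j]
  · have h1 := hf₂ (⟨p, hp⟩, N)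
    simp only at h1
    simp [hf₁0 _ (Or.inr (h.mapsTo_right.iterate N hp.1)), h1, hFN]

end HyperbolicSplitting

end Splitting

/-! ### Kernels and ranges under an intertwining surjection -/

section Extension

variable {E F G : Type*} [NormedAddCommGroup E] [NormedSpace ℂ E] [NormedAddCommGroup F]
  [NormedSpace ℂ F] [AddCommGroup G] [Module ℂ G]
  {S : E →L[ℂ] E} {S' : F →L[ℂ] F} {r : E →L[ℂ] F}

/-- If `r` intertwines `S` and `S'` and `S` is onto on `ker r`, then `ker S` is the product of
`ker S'` and of any space parametrizing `ker S ∩ ker r`. -/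
theorem nonempty_kerEquiv (hr : Surjective r) (hcomm : ∀ x, r (S x) = S' (r x))
    (hsolve : ∀ g, r g = 0 → ∃ f, r f = 0 ∧ S f = g) (e : E →ₗ[ℂ] G)
    (he : ∀ x, S x = 0 → r x = 0 → e x = 0 → x = 0)
    (he' : ∀ c, ∃ x, S x = 0 ∧ r x = 0 ∧ e x = c) :
    Nonempty (LinearMap.ker (S : E →ₗ[ℂ] E) ≃ₗ[ℂ] LinearMap.ker (S' : F →ₗ[ℂ] F) × G) := by
  have hmaps : ∀ x ∈ LinearMap.ker (S : E →ₗ[ℂ] E), (r : E →ₗ[ℂ] F) x ∈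
      LinearMap.ker (S' : F →ₗ[ℂ] F) := fun x hx => by
    have hx : S x = 0 := hx
    change S' (r x) = 0
    rw [← hcomm, hx, map_zero]
  refine ⟨LinearEquiv.ofBijective (((r : E →ₗ[ℂ] F).restrict hmaps).prod
    (e.comp (LinearMap.ker (S : E →ₗ[ℂ] E)).subtype)) ⟨?_, ?_⟩⟩
  · rw [← LinearMap.ker_eq_bot, LinearMap.ker_eq_bot']
    rintro ⟨x, hx⟩ h
    obtain ⟨h1, h2⟩ := Prod.ext_iff.1 h
    exact Subtype.ext (he x hx (congrArg Subtype.val h1) h2)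
  · rintro ⟨⟨y, hy⟩, c⟩
    have hy : S' y = 0 := hy
    obtain ⟨x, rfl⟩ := hr y
    obtain ⟨f, hf, hSf⟩ := hsolve (S x) (by rw [hcomm, hy])
    obtain ⟨z, hz, hrz, hez⟩ := he' (c - e (x - f))
    refine ⟨⟨x - f + z, ?_⟩, Prod.ext (Subtype.ext ?_) ?_⟩
    · change S (x - f + z) = 0
      simp [hSf, hz]
    · change r (x - f + z) = r x
      simp [hf, hrz]
    · change e (x - f + z) = c
      rw [map_add, hez]
      abel

theorem range_eq_preimage (hr : Surjective r) (hcomm : ∀ x, r (S x) = S' (r x))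
    (hsolve : ∀ g, r g = 0 → ∃ f, r f = 0 ∧ S f = g) : range S = r ⁻¹' range S' := by
  ext g
  constructor
  · rintro ⟨f, rfl⟩
    exact ⟨r f, (hcomm f).symm⟩
  · rintro ⟨y, hy⟩
    obtain ⟨f, rfl⟩ := hr y
    obtain ⟨f', -, hf'⟩ := hsolve (g - S f) (by rw [map_sub, hcomm, hy, sub_self])
    exact ⟨f + f', by rw [map_add, hf']; abel⟩

theorem isUpperSemiFredholm_iff_of_extension [CompleteSpace E] [CompleteSpace F]
    [FiniteDimensional ℂ G] (hr : Surjective r) (hcomm : ∀ x, r (S x) = S' (r x))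
    (hsolve : ∀ g, r g = 0 → ∃ f, r f = 0 ∧ S f = g) (e : E →ₗ[ℂ] G)
    (he : ∀ x, S x = 0 → r x = 0 → e x = 0 → x = 0)
    (he' : ∀ c, ∃ x, S x = 0 ∧ r x = 0 ∧ e x = c) :
    IsUpperSemiFredholm S ↔ IsUpperSemiFredholm S' := by
  obtain ⟨eq⟩ := nonempty_kerEquiv hr hcomm hsolve e he he'
  refine and_congr ⟨fun h => ?_, fun h => ?_⟩ ?_
  · exact Module.Finite.of_surjective ((LinearMap.fst ℂ _ _).comp eq.toLinearMap)
      (Prod.fst_surjective.comp eq.surjective)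
  · exact Module.Finite.equiv eq.symm
  · rw [range_eq_preimage hr hcomm hsolve]
    -- By the open mapping theorem `r` is a quotient map, so the two ranges are closed
    -- simultaneously.
    exact (r.isQuotientMap hr).isClosed_preimage

end Extension

/-- Restriction of continuous functions to a subset. -/
noncomputable def restrictCLM {X : Type*} [TopologicalSpace X] (A : Set X) :
    C(X, ℂ) →L[ℂ] C(A, ℂ) where
  toFun f := f.restrict A
  map_add' _ _ := rfl
  map_smul' _ _ := rfl
  cont := ContinuousMap.continuous_restrict A

theorem restrictCLM_eq_zero_iff {X : Type*} [TopologicalSpace X] {A : Set X} {f : C(X, ℂ)} :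
    restrictCLM A f = 0 ↔ ∀ x ∈ A, f x = 0 :=
  ⟨fun h x hx => DFunLike.congr_fun h ⟨x, hx⟩, fun h => ContinuousMap.ext fun x => h x x.2⟩

namespace HyperbolicSplitting

variable {X : Type*} [TopologicalSpace X] [CompactSpace X] [T2Space X] {φ : C(X, X)} {v : C(X, ℂ)}
  {M₁ M₂ : Set X}

theorem isUpperSemiFredholm_iff_and_finrank (h : HyperbolicSplitting φ v M₁ M₂)
    (hφ : Injective φ) :
    (IsUpperSemiFredholm (ContinuousLinearMap.id ℂ C(X, ℂ) - weightedComp φ v) ↔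
      IsUpperSemiFredholm (ContinuousLinearMap.id ℂ C(setL φ, ℂ) -
        weightedCompOn φ v (setL φ) (mapsTo_setL φ))) ∧
    (IsUpperSemiFredholm (ContinuousLinearMap.id ℂ C(X, ℂ) - weightedComp φ v) →
      Module.finrank ℂ (LinearMap.ker
        ((ContinuousLinearMap.id ℂ C(X, ℂ) - weightedComp φ v : C(X, ℂ) →L[ℂ] C(X, ℂ)) :
          C(X, ℂ) →ₗ[ℂ] C(X, ℂ))) =
      Module.finrank ℂ (LinearMap.ker
        ((ContinuousLinearMap.id ℂ C(setL φ, ℂ) - weightedCompOn φ v (setL φ) (mapsTo_setL φ) :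
          C(setL φ, ℂ) →L[ℂ] C(setL φ, ℂ)) : C(setL φ, ℂ) →ₗ[ℂ] C(setL φ, ℂ))) +
      (M₂ \ φ '' M₂).ncard) := by
  have hLc := isClosed_setL φ
  have := isCompact_iff_compactSpace.1 hLc.isCompact
  have := h.finite.to_subtype
  have := Fintype.ofFinite ↥(M₂ \ φ '' M₂)
  obtain ⟨n, N, q, hq, hN⟩ := h.exists_expanding_image
  set S := ContinuousLinearMap.id ℂ C(X, ℂ) - weightedComp φ v with hS
  set S' := ContinuousLinearMap.id ℂ C(setL φ, ℂ) -
    weightedCompOn φ v (setL φ) (mapsTo_setL φ) with hS'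
  have hSapp : ∀ f x, S f x = f x - v x * f (φ x) := fun f x => rfl
  have hr : Surjective (restrictCLM (setL φ)) := fun f =>
    ContinuousMap.exists_restrict_eq hLc f
  have hcomm : ∀ f, restrictCLM (setL φ) (S f) = S' (restrictCLM (setL φ) f) := fun f => rfl
  have hsol : ∀ g, restrictCLM (setL φ) g = 0 → ∀ c : X → ℂ,
      ∃ f, restrictCLM (setL φ) f = 0 ∧ S f = g ∧ ∀ p ∈ M₂ \ φ '' M₂, f (φ^[N] p) = c p := by
    intro g hg c
    obtain ⟨f, hf0, hf, hfc⟩ := h.exists_solution hφ hq hN (restrictCLM_eq_zero_iff.1 hg) c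
    exact ⟨f, restrictCLM_eq_zero_iff.2 hf0, ContinuousMap.ext hf, hfc⟩
  have hsolve : ∀ g, restrictCLM (setL φ) g = 0 →
      ∃ f, restrictCLM (setL φ) f = 0 ∧ S f = g := fun g hg => by
    obtain ⟨f, hf, hf', -⟩ := hsol g hg 0
    exact ⟨f, hf, hf'⟩
  -- Evaluation at `φ^N p` rather than at `p`: weights before `N` may vanish, and then the value at
  -- `p` need not determine the solution.
  let e : C(X, ℂ) →ₗ[ℂ] (↥(M₂ \ φ '' M₂) → ℂ) :=
    { toFun := fun f p => f (φ^[N] p)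
      map_add' := fun _ _ => rfl
      map_smul' := fun _ _ => rfl }
  have he : ∀ f, S f = 0 → restrictCLM (setL φ) f = 0 → e f = 0 → f = 0 := by
    intro f hf hf0 hef
    refine h.eq_zero_of_fixed hq hN (restrictCLM_eq_zero_iff.1 hf0) (fun x => ?_) fun p hp => ?_
    · have := DFunLike.congr_fun hf x
      rw [hSapp] at this
      exact sub_eq_zero.1 this
    · exact congrFun hef ⟨p, hp⟩
  have he' : ∀ c, ∃ f, S f = 0 ∧ restrictCLM (setL φ) f = 0 ∧ e f = c := by
    classical
    intro c
    obtain ⟨f, hf, hf', hfc⟩ := hsol 0 (map_zero _) fun x => if hx : x ∈ M₂ \ φ '' M₂ then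
      c ⟨x, hx⟩ else 0
    refine ⟨f, hf', hf, funext fun p => (hfc p p.2).trans ?_⟩
    rw [dif_pos p.2]
  have hiff := isUpperSemiFredholm_iff_of_extension hr hcomm hsolve e he he'
  refine ⟨hiff, fun hfred => ?_⟩
  obtain ⟨eq⟩ := nonempty_kerEquiv hr hcomm hsolve e he he'
  have := (hiff.1 hfred).1
  rw [eq.finrank_eq, Module.finrank_prod, Module.finrank_fintype_fun_eq_card,
    ← Nat.card_eq_fintype_card, Nat.card_coe_set_eq]

end HyperbolicSplitting

/-! ### From spectral radii to contraction and expansion -/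

section FromSplitting

variable {X : Type*} [TopologicalSpace X] [CompactSpace X] [T2Space X] {φ : C(X, X)} {w : C(X, ℂ)}

theorem norm_weightProd_smul {X : Type*} (φ : X → X) (w : X → ℂ) {c : ℂ} (n : ℕ) (x : X) :
    ‖weightProd φ (fun y => c⁻¹ * w y) n x‖ = ‖weightProd φ w n x‖ / ‖c‖ ^ n := by
  rw [weightProd_smul, norm_mul, norm_pow, norm_inv, inv_pow, inv_mul_eq_div]

theorem hyperbolicSplitting_of_isSplitting {c : ℂ} (hc : c ≠ 0) {M₁ M₂ : Set X}
    (h : IsSplitting φ w c M₁ M₂) : HyperbolicSplitting φ (c⁻¹ • w) M₁ M₂ := by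
  have hc' : 0 < ‖c‖ := norm_pos_iff.2 hc
  have hsm : ∀ n x, ‖weightProd φ (c⁻¹ • w : C(X, ℂ)) n x‖ = ‖weightProd φ w n x‖ / ‖c‖ ^ n :=
    fun n x => norm_weightProd_smul φ w n x
  have := isCompact_iff_compactSpace.1 h.isClosed_left.isCompact
  have := isCompact_iff_compactSpace.1
    (isClosed_iterInter φ.continuous h.isClosed_right).isCompact
  refine ⟨h.union_eq, h.disjoint, h.isClosed_left, h.isClosed_right, h.mapsTo_left,
    h.mapsTo_right, fun g => ?_, ?_, ?_, ?_⟩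
  · rcases M₁.eq_empty_or_nonempty with rfl | hne
    · exact ⟨0, by simp⟩
    set T := weightedCompOn φ w M₁ h.mapsTo_left with hT
    have hres : c ∈ resolventSet ℂ T := by
      by_contra hmem
      have h1 : (‖c‖₊ : ENNReal) ≤ spectralRadius ℂ T :=
        le_iSup₂ (f := fun k (_ : k ∈ spectrum ℂ T) => (‖k‖₊ : ENNReal)) c hmem
      refine (h.radius_left hne).not_ge (le_of_eq_of_le ?_ h1)
      rw [ofReal_norm, enorm_eq_nnnorm]
    obtain ⟨u, hu⟩ := (spectrum.mem_resolventSet_iff.1 hres)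
    obtain ⟨f, hf⟩ := ContinuousMap.exists_restrict_eq h.isClosed_left
      ((↑u⁻¹ : C(M₁, ℂ) →L[ℂ] C(M₁, ℂ)) (c • g.restrict M₁))
    refine ⟨f, fun x hx => ?_⟩
    have h2 : (u : C(M₁, ℂ) →L[ℂ] C(M₁, ℂ)) (f.restrict M₁) = c • g.restrict M₁ := by
      rw [hf, ← mul_apply_eq_comp, Units.mul_inv]; rfl
    rw [hu] at h2
    have h3 : c * f x - w x * f (φ x) = c * g x := DFunLike.congr_fun h2 ⟨x, hx⟩
    simp only [ContinuousMap.smul_apply, smul_eq_mul]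
    field_simp
    linear_combination h3
  · rcases M₁.eq_empty_or_nonempty with rfl | hne
    · exact ⟨0, by simp⟩
    obtain ⟨n, -, hn⟩ := exists_norm_pow_lt_of_spectralRadius_lt_continuousMap
      (weightedCompOn φ w M₁ h.mapsTo_left) hc'.le (h.radius_left hne)
    refine ⟨n, fun x hx => ?_⟩
    rw [hsm, div_lt_one (pow_pos hc' n)]
    refine lt_of_le_of_lt ?_ hn
    have h1 := ((weightedCompOn φ w M₁ h.mapsTo_left ^ n) 1).norm_coe_le_norm ⟨x, hx⟩
    rw [weightedCompOn_pow_apply, ContinuousMap.one_apply, mul_one] at h1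
    refine h1.trans ((ContinuousLinearMap.le_opNorm _ _).trans ?_)
    exact mul_le_of_le_one_right (norm_nonneg _)
      ((ContinuousMap.norm_le _ zero_le_one).2 (by simp))
  · rcases M₂.eq_empty_or_nonempty with rfl | hne
    · exact ⟨0, fun x hx => absurd (iterInter_subset _ hx) (notMem_empty x)⟩
    obtain ⟨u, hu, hrad⟩ := h.radius_right hne
    rw [ofReal_lt_one_div_iff hc'] at hrad
    obtain ⟨n, -, hn⟩ := exists_norm_pow_lt_of_spectralRadius_lt_continuousMap _ (inv_nonneg.2 hc'.le) hrad
    refine ⟨n, fun x hx => ?_⟩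
    rw [hsm, one_lt_div (pow_pos hc' n)]
    -- With `f = T⁻ⁿ`, evaluating `Tⁿ (f 1) = 1` at `x` shows that the iterated weight at `x` is the
    -- reciprocal of a value of `f 1`, which is smaller than `‖c‖⁻ⁿ` in modulus.
    set f := ((u⁻¹ : (C(iterInter φ M₂, ℂ) →L[ℂ] C(iterInter φ M₂, ℂ))ˣ) :
      C(iterInter φ M₂, ℂ) →L[ℂ] C(iterInter φ M₂, ℂ)) ^ n with hf
    have h1 : ((weightedCompOn φ w (iterInter φ M₂) (mapsTo_iterInter h.mapsTo_right)) ^ n) (f 1)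
        = 1 := by
      rw [← hu, hf, ← mul_apply_eq_comp, ← Units.val_pow_eq_pow_val, ← Units.val_pow_eq_pow_val,
        inv_pow, Units.mul_inv]; rfl
    have h2 := congrArg norm (DFunLike.congr_fun h1 ⟨x, hx⟩)
    rw [weightedCompOn_pow_apply, norm_mul] at h2
    have h3 : ‖f 1 ⟨φ^[n] x, (mapsTo_iterInter h.mapsTo_right).iterate n hx⟩‖ < (‖c‖ ^ n)⁻¹ := by
      refine ((f 1).norm_coe_le_norm _).trans_lt (((f.le_opNorm 1).trans ?_).trans_lt
        (hn.trans_eq (inv_pow _ _)))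
      exact mul_le_of_le_one_right (norm_nonneg _)
        ((ContinuousMap.norm_le _ zero_le_one).2 (by simp))
    by_contra hle
    have h4 : ‖weightProd φ w n x‖ * ‖f 1 ⟨φ^[n] x, (mapsTo_iterInter h.mapsTo_right).iterate n hx⟩‖
        < 1 := by
      calc _ ≤ ‖c‖ ^ n * ‖f 1 ⟨φ^[n] x, (mapsTo_iterInter h.mapsTo_right).iterate n hx⟩‖ := by
            gcongr; exact not_lt.1 hle
        _ < ‖c‖ ^ n * (‖c‖ ^ n)⁻¹ := by gcongr
        _ = 1 := mul_inv_cancel₀ (pow_pos hc' n).ne'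
    rw [h2] at h4
    simp at h4
  · rcases M₂.eq_empty_or_nonempty with rfl | hne
    · simp
    · exact h.finite_right hne

end FromSplitting

/-! ### A lower bound from the semi-Fredholm property -/

section Estimate

variable {X : Type*} [TopologicalSpace X]

/-- Each evaluation that is nonzero on `V` lowers the dimension of the subspace on which it
vanishes; induct. -/
theorem exists_finset_separating (V : Submodule ℂ C(X, ℂ)) [FiniteDimensional ℂ V] :
    ∃ s : Finset X, ∀ f ∈ V, (∀ x ∈ s, f x = 0) → f = 0 := by
  classical
  induction hn : Module.finrank ℂ V using Nat.strong_induction_on generalizing V with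
  | _ n ih =>
    by_cases hV : ∀ f ∈ V, f = 0
    · exact ⟨∅, fun f hf _ => hV f hf⟩
    push Not at hV
    obtain ⟨f, hf, hf0⟩ := hV
    obtain ⟨x, hx⟩ : ∃ x, f x ≠ 0 := by
      by_contra! h
      exact hf0 (ContinuousMap.ext h)
    let ev : C(X, ℂ) →ₗ[ℂ] ℂ :=
      { toFun := fun f => f x, map_add' := fun _ _ => rfl, map_smul' := fun _ _ => rfl }
    have hlt : V ⊓ LinearMap.ker ev < V :=
      lt_of_le_of_ne inf_le_left fun h => hx (LinearMap.mem_ker.1 (inf_eq_left.1 h hf) :)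
    obtain ⟨s, hs⟩ := ih _ (hn ▸ Submodule.finrank_lt_finrank_of_lt hlt) (V ⊓ LinearMap.ker ev) rfl
    refine ⟨insert x s, fun g hg h => hs g ⟨hg, h x (Finset.mem_insert_self _ _)⟩ fun y hy => ?_⟩
    exact h y (Finset.mem_insert_of_mem hy)

/-- An upper semi-Fredholm operator on `C(X)` is bounded below on the functions vanishing at
suitable finitely many points. -/
theorem IsUpperSemiFredholm.exists_estimate [CompactSpace X] {S : C(X, ℂ) →L[ℂ] C(X, ℂ)}
    (hS : IsUpperSemiFredholm S) :
    ∃ s : Finset X, ∃ C : ℝ, 1 ≤ C ∧ ∀ f, (∀ x ∈ s, f x = 0) → ‖f‖ ≤ C * ‖S f‖ := by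
  have := hS.1
  obtain ⟨s, hs⟩ := exists_finset_separating (LinearMap.ker (S : C(X, ℂ) →ₗ[ℂ] C(X, ℂ)))
  let ev : LinearMap.ker (S : C(X, ℂ) →ₗ[ℂ] C(X, ℂ)) →ₗ[ℂ] (s → ℂ) :=
    { toFun := fun f x => f.1 x, map_add' := fun _ _ => rfl, map_smul' := fun _ _ => rfl }
  obtain ⟨K, hK, hev⟩ := ev.exists_antilipschitzWith (LinearMap.ker_eq_bot'.2 fun f hf =>
    Subtype.ext (hs f f.2 fun x hx => congrFun hf ⟨x, hx⟩))
  have hcl : IsClosed (LinearMap.range (S : C(X, ℂ) →ₗ[ℂ] C(X, ℂ)) : Set C(X, ℂ)) := hS.2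
  have := hcl.completeSpace_coe
  let R : C(X, ℂ) →L[ℂ] LinearMap.range (S : C(X, ℂ) →ₗ[ℂ] C(X, ℂ)) :=
    S.codRestrict _ fun x => ⟨x, rfl⟩
  obtain ⟨C, hC, hR⟩ := R.exists_preimage_norm_le (by
    rintro ⟨_, x, rfl⟩
    exact ⟨x, rfl⟩)
  -- Choose `r` with `S r = S f` and `‖r‖ ≤ C ‖S f‖`. The kernel element `f - r` equals `-r` on `s`,
  -- so its norm is at most `K ‖r‖`. The extra `1` only ensures that the constant is at least `1`.
  refine ⟨s, (1 + K) * C + 1, by have := K.2; nlinarith [mul_nonneg this hC.le], fun f hf => ?_⟩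
  obtain ⟨r, hr, hrn⟩ := hR (R f)
  have hrS : S r = S f := congrArg Subtype.val hr
  have hrn : ‖r‖ ≤ C * ‖S f‖ := hrn
  let k : LinearMap.ker (S : C(X, ℂ) →ₗ[ℂ] C(X, ℂ)) :=
    ⟨f - r, by change S (f - r) = 0; rw [map_sub, hrS, sub_self]⟩
  have h1 : ‖k‖ ≤ K * ‖ev k‖ := by
    have := hev.le_mul_dist k 0
    rwa [map_zero, dist_zero_right, dist_zero_right] at this
  have h2 : ‖ev k‖ ≤ ‖r‖ := by
    refine (pi_norm_le_iff_of_nonneg (norm_nonneg _)).2 fun x => ?_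
    have : ev k x = -r x := by
      change f x - r x = _
      rw [hf x x.2, zero_sub]
    rw [this, norm_neg]
    exact r.norm_coe_le_norm x
  have h3 : ‖f‖ ≤ ‖k‖ + ‖r‖ := by
    have : f = (k : C(X, ℂ)) + r := (sub_add_cancel f r).symm
    calc ‖f‖ = ‖(k : C(X, ℂ)) + r‖ := by rw [← this]
      _ ≤ _ := norm_add_le _ _
  have h4 : (K : ℝ) * ‖ev k‖ ≤ K * (C * ‖S f‖) := by gcongr; exact h2.trans hrn
  nlinarith [norm_nonneg (S f)]

end Estimate

/-! ### Uniform decay and growth of iterated weights -/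

section Uniform

variable {X : Type*} {φ : X → X} {v : X → ℂ} {A B : Set X}

/-- The iterated weights tend to `0` uniformly on `A`. -/
def UniformDecay (φ : X → X) (v : X → ℂ) (A : Set X) : Prop :=
  ∀ ε > 0, ∃ n₀ : ℕ, ∀ n ≥ n₀, ∀ x ∈ A, ‖weightProd φ v n x‖ ≤ ε

/-- The iterated weights tend to infinity uniformly on `A`. -/
def UniformGrowth (φ : X → X) (v : X → ℂ) (A : Set X) : Prop :=
  ∀ R : ℝ, ∃ n₀ : ℕ, ∀ n ≥ n₀, ∀ x ∈ A, R ≤ ‖weightProd φ v n x‖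

theorem UniformDecay.mono (h : UniformDecay φ v B) (hAB : A ⊆ B) : UniformDecay φ v A :=
  fun ε hε => (h ε hε).imp fun _ hn n hn' x hx => hn n hn' x (hAB hx)

theorem UniformDecay.union (hA : UniformDecay φ v A) (hB : UniformDecay φ v B) :
    UniformDecay φ v (A ∪ B) := fun ε hε => by
  obtain ⟨a, ha⟩ := hA ε hε
  obtain ⟨b, hb⟩ := hB ε hε
  exact ⟨max a b, fun n hn x hx => hx.elim (ha n (le_of_max_le_left hn) x)
    (hb n (le_of_max_le_right hn) x)⟩

theorem UniformDecay.biUnion {ι : Type*} {s : Set ι} (hs : s.Finite) {A : ι → Set X}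
    (h : ∀ i ∈ s, UniformDecay φ v (A i)) : UniformDecay φ v (⋃ i ∈ s, A i) := by
  induction s, hs using Set.Finite.induction_on with
  | empty => exact fun ε _ => ⟨0, by simp⟩
  | insert _ _ ih =>
    rw [biUnion_insert]
    exact (h _ (mem_insert _ _)).union (ih fun i hi => h i (mem_insert_of_mem _ hi))

theorem UniformGrowth.biUnion {ι : Type*} {s : Set ι} (hs : s.Finite) {A : ι → Set X}
    (h : ∀ i ∈ s, UniformGrowth φ v (A i)) : UniformGrowth φ v (⋃ i ∈ s, A i) := by
  induction s, hs using Set.Finite.induction_on with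
  | empty => exact fun ε => ⟨0, by simp⟩
  | insert _ _ ih =>
    rw [biUnion_insert]
    intro R
    obtain ⟨a, ha⟩ := h _ (mem_insert _ _) R
    obtain ⟨b, hb⟩ := ih (fun i hi => h i (mem_insert_of_mem _ hi)) R
    exact ⟨max a b, fun n hn x hx => hx.elim (ha n (le_of_max_le_left hn) x)
      (hb n (le_of_max_le_right hn) x)⟩

theorem UniformDecay.closure [TopologicalSpace X] (hφ : Continuous φ) (hv : Continuous v)
    (h : UniformDecay φ v A) : UniformDecay φ v (closure A) := fun ε hε =>
  (h ε hε).imp fun _ hn n hn' => closure_minimal (hn n hn')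
    (isClosed_le (continuous_weightProd hφ hv n).norm continuous_const)

theorem UniformGrowth.closure [TopologicalSpace X] (hφ : Continuous φ) (hv : Continuous v)
    (h : UniformGrowth φ v A) : UniformGrowth φ v (closure A) := fun R =>
  (h R).imp fun _ hn n hn' => closure_minimal (hn n hn')
    (isClosed_le continuous_const (continuous_weightProd hφ hv n).norm)

theorem UniformDecay.singleton_of_map {x : X} (h : UniformDecay φ v {φ x}) :
    UniformDecay φ v {x} := by
  intro ε hε
  obtain ⟨n₀, hn₀⟩ := h (ε / (‖v x‖ + 1)) (by positivity)
  refine ⟨n₀ + 1, fun n hn y hy => ?_⟩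
  obtain rfl := mem_singleton_iff.1 hy
  obtain ⟨k, rfl⟩ := Nat.exists_eq_add_of_le' (Nat.one_le_of_lt hn)
  have h1 := hn₀ k (by omega) _ rfl
  rw [le_div_iff₀ (by positivity)] at h1
  rw [weightProd_succ, norm_mul]
  nlinarith [norm_nonneg (weightProd φ v k (φ y)), norm_nonneg (v y)]

theorem UniformDecay.singleton_of_iterate {x : X} {k : ℕ} (h : UniformDecay φ v {φ^[k] x}) :
    UniformDecay φ v {x} := by
  induction k generalizing x with
  | zero => exact h
  | succ k ih => exact UniformDecay.singleton_of_map (ih h)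

/-- The trajectory `x, φ x, φ² x, …`. -/
def trajectory (φ : X → X) (x : X) : Set X := range fun n : ℕ => φ^[n] x

theorem mapsTo_trajectory (φ : X → X) (x : X) :
    MapsTo φ (trajectory φ x) (trajectory φ x) := by
  rintro _ ⟨n, rfl⟩
  exact ⟨n + 1, iterate_succ_apply' _ _ _⟩

/-- Decay passes to earlier points, since finitely many bounded factors are added. Growth does not,
because these factors may vanish; hence the asymmetry between decay and eventual growth below. -/
theorem UniformDecay.trajectory_of_iterate {x : X} {k : ℕ}
    (h : UniformDecay φ v (trajectory φ (φ^[k] x))) : UniformDecay φ v (trajectory φ x) := by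
  have hsub : trajectory φ x ⊆ (⋃ j ∈ {j | j < k}, {φ^[j] x}) ∪ trajectory φ (φ^[k] x) := by
    rintro _ ⟨n, rfl⟩
    rcases lt_or_ge n k with hn | hn
    · exact Or.inl (mem_biUnion (show n ∈ {j | j < k} from hn) rfl)
    · refine Or.inr ⟨n - k, ?_⟩
      simp only [← iterate_add_apply]
      congr 1
      omega
  refine (UniformDecay.union (UniformDecay.biUnion (finite_lt_nat k) fun j hj => ?_) h).mono hsub
  refine UniformDecay.singleton_of_iterate (k := k - j) (h.mono ?_)
  rintro _ rfl
  refine ⟨0, ?_⟩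
  have hjk : j < k := hj
  change φ^[k] x = φ^[k - j] (φ^[j] x)
  rw [← iterate_add_apply, Nat.sub_add_cancel hjk.le]

theorem UniformDecay.not_growth (h : UniformDecay φ v A) (h' : UniformGrowth φ v B) :
    Disjoint A B := by
  rw [Set.disjoint_left]
  intro x hA hB
  obtain ⟨a, ha⟩ := h 1 one_pos
  obtain ⟨b, hb⟩ := h' 2
  have h1 := ha _ (le_max_left a b) x hA
  have h2 := hb _ (le_max_right a b) x hB
  linarith

end Uniform

/-! ### The dichotomy for weighted shifts on sequences -/

section Dichotomy

theorem abs_weightProd_div (w : ℕ → ℂ) (hw : ∀ n, w n ≠ 0) (m n : ℕ) :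
    ‖weightProd Nat.succ w m n‖ =
      ‖weightProd Nat.succ w (n + m) 0‖ / ‖weightProd Nat.succ w n 0‖ := by
  have h0 : weightProd Nat.succ w n 0 ≠ 0 := Finset.prod_ne_zero_iff.2 fun _ _ => hw _
  rw [weightProd_add, norm_mul, mul_div_cancel_left₀ _ (norm_ne_zero_iff.2 h0)]
  simp [Nat.succ_iterate]

/-- If the operator `f(n) ↦ f(n) - w(n) f(n+1)` on finitely supported sequences vanishing at `0`
is bounded below, then the iterated weights either decay or grow uniformly. -/
theorem uniformDecay_or_uniformGrowth {w : ℕ → ℂ} {C : ℝ} (hC : 1 ≤ C)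
    (H : ∀ f : ℕ → ℂ, (support f).Finite → f 0 = 0 → ∀ D : ℝ,
      (∀ n, ‖f n - w n * f (n + 1)‖ ≤ D) → ∀ n, ‖f n‖ ≤ C * D) :
    (∃ N, UniformDecay Nat.succ w (Ici N)) ∨ UniformGrowth Nat.succ w univ := by
  have hC0 : 0 < C := by linarith
  by_cases hw : ∃ a, w a = 0
  · obtain ⟨a, ha⟩ := hw
    left
    refine ⟨a + 1, ?_⟩
    -- Let `f` be the backward orbit of the unit mass at `t = n + i`, cut off at `a`, which costs
    -- nothing as `w a = 0`. The operator sends `f` to that unit mass, and `(t - j + 1) f` to `f`;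
    -- the estimate is used twice.
    have key : ∀ n > a, ∀ i : ℕ, (i + 1) * ‖weightProd Nat.succ w i n‖ ≤ C * (C * 1) := by
      intro n hn i
      set t := n + i with ht
      set f : ℕ → ℂ := fun j => if a < j ∧ j ≤ t then weightProd Nat.succ w (t - j) j else 0
        with hf
      have hfin : (support f).Finite := (finite_Iic t).subset fun j hj => by
        by_contra hjt
        exact hj (if_neg fun h => hjt h.2)
      have hrec : ∀ j, a < j → j < t → f j = w j * f (j + 1) := by
        intro j h1 h2
        have h3 : t - j = (t - (j + 1)) + 1 := by omega
        simp only [hf, if_pos (show a < j ∧ j ≤ t by omega),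
          if_pos (show a < j + 1 ∧ j + 1 ≤ t by omega)]
        rw [h3, weightProd_succ]
      have hlow : ∀ j ≤ a, f j = 0 := fun j hj => if_neg (by omega)
      have hhigh : ∀ j > t, f j = 0 := fun j hj => if_neg (by omega)
      have htop : f t = 1 := by simp [hf, show a < t by omega]
      have hlow' : ∀ j ≤ a, w j * f (j + 1) = 0 := fun j hj => by
        rcases hj.lt_or_eq with h | rfl
        · rw [hlow _ h, mul_zero]
        · rw [ha, zero_mul]
      have hf1 : ∀ j, ‖f j‖ ≤ C * 1 := by
        refine H f hfin (hlow 0 (Nat.zero_le a)) 1 fun j => ?_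
        rcases le_or_gt j a with h1 | h1
        · simp [hlow j h1, hlow' j h1]
        rcases lt_trichotomy j t with h2 | h2 | h2
        · simp [← hrec j h1 h2]
        · simp [h2, htop, hhigh (t + 1) (by omega)]
        · simp [hhigh j h2, hhigh (j + 1) (by omega)]
      have hf2 := H (fun j => ((t : ℂ) - j + 1) * f j)
        (hfin.subset (support_mul_subset_right _ _)) (by simp [hlow 0 (Nat.zero_le a)]) (C * 1)
        (fun j => by
          refine le_trans (le_of_eq ?_) (hf1 j)
          rcases le_or_gt j a with h1 | h1
          · simp [hlow j h1, mul_left_comm (w j), hlow' j h1]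
          rcases lt_trichotomy j t with h2 | h2 | h2
          · congr 1
            push_cast
            linear_combination (t - j : ℂ) * hrec j h1 h2
          · simp [h2, hhigh (t + 1) (by omega)]
          · simp [hhigh j h2, hhigh (j + 1) (by omega)]) n
      have h5 : f n = weightProd Nat.succ w i n := by
        simp [hf, hn, ht]
      rw [h5, norm_mul] at hf2
      refine le_trans (le_of_eq ?_) hf2
      congr 1
      have : (t : ℂ) - n + 1 = ((i + 1 : ℕ) : ℂ) := by rw [ht]; push_cast; ring
      rw [this, Complex.norm_natCast]
      push_cast
      rfl
    intro ε hε
    obtain ⟨n₀, hn₀⟩ := exists_nat_gt (C * (C * 1) / ε)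
    refine ⟨n₀, fun i hi n hn => ?_⟩
    have h1 := key n hn i
    rw [div_lt_iff₀ hε] at hn₀
    have h2 : (n₀ : ℝ) ≤ i := by exact_mod_cast hi
    have h3 : (n₀ : ℝ) * ε ≤ (i + 1) * ε := by gcongr; linarith
    have h4 : (0 : ℝ) < i + 1 := by positivity
    exact le_of_mul_le_mul_left (h1.trans (hn₀.le.trans h3)) h4
  push Not at hw
  set W : ℕ → ℂ := fun n => weightProd Nat.succ w n 0 with hW
  have hW0 : ∀ n, W n ≠ 0 := fun n => Finset.prod_ne_zero_iff.2 fun _ _ => hw _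
  set P : ℕ → ℝ := fun n => ‖W n‖ with hP
  have hP0 : ∀ n, 0 < P n := fun n => norm_pos_iff.2 (hW0 n)
  have hWs : ∀ n, W (n + 1) = W n * w n := fun n => by
    simp only [hW]
    rw [weightProd_add]
    simp [Nat.succ_iterate]
  -- `α` sums the `P j` from the left and `β t` sums them from `n` up to `t`. The test sequence `min
  -- α (β t) / W` vanishes at `0` and beyond `t`; as each sum changes by at most `P n` in a step,
  -- its image is bounded by `1`.
  set α : ℕ → ℝ := fun n => ∑ j ∈ Finset.range n, P j with hα
  set β : ℕ → ℕ → ℝ := fun t n => ∑ j ∈ Finset.Ico n (t + 1), P j with hβ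
  have hαs : ∀ n, α (n + 1) = α n + P n := fun n => Finset.sum_range_succ _ _
  have hβs : ∀ t n, n ≤ t → β t n = P n + β t (n + 1) := fun t n h =>
    Finset.sum_eq_sum_Ico_succ_bot (by omega) _
  have hβ0 : ∀ t n, t < n → β t n = 0 := fun t n h => by
    simp only [hβ]
    rw [Finset.Ico_eq_empty (by omega), Finset.sum_empty]
  have hα0 : ∀ n, 0 ≤ α n := fun n => Finset.sum_nonneg fun j _ => (hP0 j).le
  have hβnn : ∀ t n, 0 ≤ β t n := fun t n => Finset.sum_nonneg fun j _ => (hP0 j).le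
  have key : ∀ t n, min (α n) (β t n) ≤ C * P n := by
    intro t n
    have h1 := H (fun n => ((min (α n) (β t n) : ℝ) : ℂ) / W n) ((finite_Iic t).subset fun j hj => by
        by_contra hjt
        refine hj ?_
        simp [hβ0 t j (by simpa using hjt), hα0 j]) (by simp [hα, hβnn t 0]) 1 (fun n => by
        have h2 : ((min (α n) (β t n) : ℝ) : ℂ) / W n -
            w n * (((min (α (n + 1)) (β t (n + 1)) : ℝ) : ℂ) / W (n + 1)) =
            ((min (α n) (β t n) - min (α (n + 1)) (β t (n + 1)) : ℝ) : ℂ) / W n := by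
          rw [hWs]
          have := hW0 n
          have := hw n
          push_cast
          field_simp
        rw [h2, norm_div, Complex.norm_real, Real.norm_eq_abs, div_le_one (hP0 n)]
        refine (abs_min_sub_min_le_max _ _ _ _).trans (max_le ?_ ?_)
        · rw [hαs, abs_sub_comm, add_sub_cancel_left, abs_of_pos (hP0 n)]
        · rcases le_or_gt n t with h | h
          · rw [hβs t n h, add_sub_cancel_right, abs_of_pos (hP0 n)]
          · rw [hβ0 t n h, hβ0 t (n + 1) (by omega)]
            simpa using (hP0 n).le) n
    rw [norm_div, Complex.norm_real, Real.norm_eq_abs, abs_of_nonneg (le_min (hα0 n) (hβnn t n)),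
      div_le_iff₀ (hP0 n)] at h1
    linarith
  -- If `P` is summable, `α n` eventually exceeds `C * P n`, so the tails satisfy `β ≤ C P` and
  -- decay geometrically. Otherwise `β t n` is unbounded in `t`, so `α ≤ C P` and `α` grows
  -- geometrically.
  by_cases hsum : Summable P
  · left
    have h1 : Tendsto (fun n => α n - C * P n) atTop (𝓝 (∑' n, P n - C * 0)) :=
      hsum.hasSum.tendsto_sum_nat.sub (hsum.tendsto_atTop_zero.const_mul C)
    have h2 : 0 < ∑' n, P n - C * 0 := by
      rw [mul_zero, sub_zero]
      exact hsum.tsum_pos (fun n => (hP0 n).le) 0 (hP0 0)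
    obtain ⟨N, hN⟩ := (h1.eventually_const_lt h2).exists_forall_of_atTop
    have hβle : ∀ t, ∀ n ≥ N, β t n ≤ C * P n := fun t n hn => by
      have h3 := hN n hn
      exact (min_le_iff.1 (key t n)).resolve_left (by linarith)
    -- From `β ≤ C P`, passing from `n` to `n + 1` removes at least the fraction `C⁻¹` of the tail.
    set r := 1 - C⁻¹ with hr
    have hr0 : 0 ≤ r := sub_nonneg.2 (inv_le_one_of_one_le₀ hC)
    have hr1 : r < 1 := sub_lt_self _ (inv_pos.2 hC0)
    have hdec : ∀ t m, ∀ n ≥ N, n + m ≤ t → β t (n + m) ≤ r ^ m * β t n := by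
      intro t m n hn
      induction m with
      | zero => simp
      | succ m ih =>
        intro h
        have h3 := ih (by omega)
        have h4 := hβs t (n + m) (by omega)
        have h5 := hβle t (n + m) (by omega)
        have h6 : C⁻¹ * β t (n + m) ≤ P (n + m) := by
          rw [inv_mul_eq_div, div_le_iff₀ hC0]; linarith
        rw [← add_assoc, pow_succ']
        calc β t (n + m + 1) ≤ r * β t (n + m) := by rw [hr]; linarith
          _ ≤ r * (r ^ m * β t n) := by gcongr
          _ = _ := by ring
    refine ⟨N, fun ε hε => ?_⟩
    have hlim : Tendsto (fun m : ℕ => r ^ m * C) atTop (𝓝 0) := by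
      simpa using (tendsto_pow_atTop_nhds_zero_of_lt_one hr0 hr1).mul_const C
    obtain ⟨m₀, hm₀⟩ := (hlim.eventually_lt_const hε).exists_forall_of_atTop
    refine ⟨m₀, fun m hm n hn => ?_⟩
    rw [abs_weightProd_div w hw, div_le_iff₀ (hP0 n)]
    calc P (n + m) ≤ β (n + m) (n + m) := by
          rw [hβs _ _ le_rfl]
          linarith [hβnn (n + m) (n + m + 1)]
      _ ≤ r ^ m * β (n + m) n := hdec _ m n hn le_rfl
      _ ≤ r ^ m * (C * P n) := by gcongr; exact hβle _ n hn
      _ = r ^ m * C * P n := by ring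
      _ ≤ ε * P n := mul_le_mul_of_nonneg_right (hm₀ m hm).le (hP0 n).le
  · right
    have hαle : ∀ n, α n ≤ C * P n := by
      intro n
      have h1 := (not_summable_iff_tendsto_nat_atTop_of_nonneg fun n => (hP0 n).le).1 hsum
      obtain ⟨t, ht, htn⟩ := ((h1.eventually_gt_atTop (α n + C * P n)).and
        (eventually_ge_atTop (n + 1))).exists
      have h2 : α n + β (t - 1) n = ∑ j ∈ Finset.range t, P j := by
        simp only [hα, hβ]
        rw [Nat.sub_add_cancel (by omega), Finset.sum_range_add_sum_Ico _ (by omega)]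
      exact (min_le_iff.1 (key (t - 1) n)).resolve_right (by linarith)
    have hgrow : ∀ n m, (1 + C⁻¹) ^ m * α n ≤ α (n + m) := by
      intro n m
      induction m with
      | zero => simp
      | succ m ih =>
        have h6 : C⁻¹ * α (n + m) ≤ P (n + m) := by
          rw [inv_mul_eq_div, div_le_iff₀ hC0]; linarith [hαle (n + m)]
        rw [← add_assoc, hαs, pow_succ']
        calc (1 + C⁻¹) * (1 + C⁻¹) ^ m * α n = (1 + C⁻¹) * ((1 + C⁻¹) ^ m * α n) := by ring
          _ ≤ (1 + C⁻¹) * α (n + m) := by gcongr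
          _ ≤ _ := by linarith
    intro R
    have hlim := tendsto_pow_atTop_atTop_of_one_lt (r := 1 + C⁻¹) (by
      have := inv_pos.2 hC0; linarith)
    obtain ⟨m₀, hm₀⟩ := (hlim.eventually_ge_atTop (C * R)).exists_forall_of_atTop
    refine ⟨m₀ + 1, fun m hm n _ => ?_⟩
    obtain ⟨k, rfl⟩ := Nat.exists_eq_add_of_le' (Nat.one_le_of_lt hm)
    rw [abs_weightProd_div w hw, le_div_iff₀ (hP0 n)]
    have h1 := hm₀ k (by omega)
    have h2 : P n ≤ α (n + 1) := by rw [hαs]; linarith [hα0 n]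
    have h3 := hgrow (n + 1) k
    have h4 := hαle (n + 1 + k)
    have h5 : n + 1 + k = n + (k + 1) := by ring
    rw [h5] at h3 h4
    have h6 : C * R * P n ≤ (1 + C⁻¹) ^ k * α (n + 1) := by
      have : 0 < 1 + C⁻¹ := by positivity
      exact mul_le_mul h1 h2 (hP0 n).le (by positivity)
    have h7 : C * (R * P n) ≤ C * P (n + (k + 1)) := by linarith
    exact le_of_mul_le_mul_left h7 hC0

end Dichotomy

/-! ### Consequences of the lower bound along trajectories -/

section Estimate

theorem sum_range_succ_smul_sub {M : Type*} [AddCommGroup M] (a : ℕ → M) (N : ℕ) :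
    ∑ j ∈ Finset.range N, (j + 1) • (a j - a (j + 1)) = ∑ j ∈ Finset.range N, a j - N • a N := by
  induction N with
  | zero => simp
  | succ N ih =>
    rw [Finset.sum_range_succ, ih, Finset.sum_range_succ, smul_sub, add_smul, one_smul]
    abel

variable {X : Type*} [TopologicalSpace X] [CompactSpace X] [T2Space X] {φ : C(X, X)} {v : C(X, ℂ)}
  {s : Finset X} {C : ℝ}

/-- If `1 - T` is bounded below on the functions vanishing on the finite set `s`, the iterated
weights decay along the trajectories which start outside `φ(X)` and avoid `s`. -/
theorem mul_weightProd_le_of_estimate (hφ : Injective φ) (hC : 1 ≤ C)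
    (hE : ∀ f : C(X, ℂ), (∀ x ∈ s, f x = 0) → ‖f‖ ≤ C * ‖f - weightedComp φ v f‖) {p : X}
    (hp : p ∉ range φ) (hps : ∀ n : ℕ, φ^[n] p ∉ s) (k i : ℕ) :
    (i + 1) * ‖weightProd φ v i (φ^[k] p)‖ ≤ C * (C * 1) := by
  classical
  have hpA : p ∈ univ \ φ '' univ := ⟨mem_univ _, by rwa [image_univ]⟩
  set n := k + i with hn
  set z := φ^[n] p with hz
  -- A bump `h` at `z` vanishing on `B`: the first piece gives `T^(n+1) h = 0`, the second makes
  -- `T^j h` vanish on `s` for `j ≤ n`, and the third leaves only the term `j = i` at `φ^k p`, since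
  -- `j + k ≤ 2n`.
  set B : Set X := φ^[n + 1] '' univ ∪ ((⋃ j ∈ Finset.range (n + 1), φ^[j] '' s) ∪
    ⋃ m ∈ (Finset.range (2 * n + 1)).erase n, {φ^[m] p}) with hB
  have hBc : IsClosed B := by
    refine (isCompact_univ.image (φ.continuous.iterate _)).isClosed.union (IsClosed.union ?_ ?_)
    · exact (Finset.finite_toSet _).isClosed_biUnion fun j _ => (s.finite_toSet.image _).isClosed
    · exact (Finset.finite_toSet _).isClosed_biUnion fun j _ => isClosed_singleton
  have hzB : z ∉ B := by
    rintro (h | h | h)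
    · exact iterate_notMem_image_succ hφ hpA.2 n h
    · simp only [mem_iUnion] at h
      obtain ⟨j, hj, y, hy, hyz⟩ := h
      have hjn : j ≤ n := by simpa [Nat.lt_succ_iff] using hj
      have : φ^[j] (φ^[n - j] p) = φ^[j] y := by
        rw [hyz, ← iterate_add_apply, Nat.add_sub_cancel' hjn]
      rw [← hφ.iterate j this] at hy
      exact hps _ hy
    · simp only [mem_iUnion] at h
      obtain ⟨m, hm, hmz⟩ := h
      have := (iterate_inj_of_notMem_image hφ (mapsTo_univ φ univ) hpA hpA hmz).2
      exact (Finset.mem_erase.1 hm).1 this.symm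
  obtain ⟨b, hb0, hb1, hbI⟩ := exists_continuous_zero_one_of_isClosed hBc isClosed_singleton
    (disjoint_singleton_right.2 hzB)
  set h : C(X, ℂ) := ⟨fun x => (b x : ℂ), Complex.continuous_ofReal.comp b.continuous⟩ with hh
  have hhapp : ∀ x, h x = (b x : ℂ) := fun x => rfl
  have hhn : ‖h‖ ≤ 1 := by
    refine (ContinuousMap.norm_le _ zero_le_one).2 fun x => ?_
    rw [hhapp, Complex.norm_real, Real.norm_eq_abs, abs_of_nonneg (hbI x).1]
    exact (hbI x).2
  have hhB : ∀ x ∈ B, h x = 0 := fun x hx => by rw [hhapp, hb0 hx]; rfl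
  have hhz : h z = 1 := by rw [hhapp, hb1 (mem_singleton z)]; rfl
  set T := weightedComp φ v with hT
  set U : ℕ → C(X, ℂ) := fun j => (T ^ j) h with hU
  have hUapp : ∀ j x, U j x = weightProd φ v j x * h (φ^[j] x) := fun j x =>
    weightedComp_pow_apply φ v j h x
  have hUT : ∀ j, T (U j) = U (j + 1) := fun j => by
    simp only [hU, pow_succ', mul_apply_eq_comp]
  have hUn : U (n + 1) = 0 := by
    ext x
    rw [hUapp, hhB _ (Or.inl ⟨x, mem_univ _, rfl⟩), mul_zero, ContinuousMap.zero_apply]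
  have hUs : ∀ j < n + 1, ∀ x ∈ s, U j x = 0 := fun j hj x hx => by
    rw [hUapp, hhB _ (Or.inr (Or.inl ?_)), mul_zero]
    exact mem_biUnion (Finset.mem_coe.2 (Finset.mem_range.2 hj)) ⟨x, hx, rfl⟩
  have hsum : ∀ (a : ℕ → ℕ) x, (∑ j ∈ Finset.range (n + 1), a j • U j) x =
      ∑ j ∈ Finset.range (n + 1), a j • U j x := fun a x => by
    rw [ContinuousMap.sum_apply]; rfl
  have hf1 : ‖∑ j ∈ Finset.range (n + 1), U j‖ ≤ C * 1 := by
    refine (hE _ fun x hx => ?_).trans ?_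
    · rw [ContinuousMap.sum_apply]
      exact Finset.sum_eq_zero fun j hj => hUs j (Finset.mem_range.1 hj) x hx
    · have : ∑ j ∈ Finset.range (n + 1), U j - T (∑ j ∈ Finset.range (n + 1), U j) = h := by
        rw [map_sum, ← Finset.sum_sub_distrib]
        simp only [hUT]
        rw [Finset.sum_range_sub', hUn, sub_zero]
        simp [hU]
      rw [this]
      gcongr
  have hf2 : ‖∑ j ∈ Finset.range (n + 1), (j + 1) • U j‖ ≤ C * (C * 1) := by
    refine (hE _ fun x hx => ?_).trans ?_
    · rw [hsum]
      exact Finset.sum_eq_zero fun j hj => by rw [hUs j (Finset.mem_range.1 hj) x hx, smul_zero]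
    -- Telescoping by parts: `1 - T` turns `∑ (j + 1) T^j h` into `∑ T^j h`, whose norm is already
    -- bounded by `C`.
    · have : ∑ j ∈ Finset.range (n + 1), (j + 1) • U j -
          T (∑ j ∈ Finset.range (n + 1), (j + 1) • U j) = ∑ j ∈ Finset.range (n + 1), U j := by
        rw [map_sum, ← Finset.sum_sub_distrib]
        simp only [map_nsmul, hUT, ← smul_sub]
        rw [sum_range_succ_smul_sub, hUn, smul_zero, sub_zero]
      rw [this]
      gcongr
  have hval : (∑ j ∈ Finset.range (n + 1), (j + 1) • U j) (φ^[k] p) =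
      ((i + 1 : ℕ) : ℂ) * weightProd φ v i (φ^[k] p) := by
    rw [hsum, Finset.sum_eq_single i]
    · rw [hUapp, ← iterate_add_apply, add_comm i k, ← hn, ← hz, hhz, mul_one, nsmul_eq_mul]
    · intro j hj hji
      rw [hUapp, ← iterate_add_apply, hhB _ (Or.inr (Or.inr ?_)), mul_zero, smul_zero]
      have hj := Finset.mem_range.1 hj
      exact mem_biUnion (x := j + k) (Finset.mem_coe.2 (Finset.mem_erase.2
        ⟨by omega, Finset.mem_range.2 (by omega)⟩)) rfl
    · intro hi
      exact absurd (Finset.mem_range.2 (by omega)) hi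
  have := (ContinuousMap.norm_coe_le_norm _ (φ^[k] p)).trans hf2
  rw [hval, norm_mul, Complex.norm_natCast] at this
  exact_mod_cast this

theorem UniformDecay.of_sequence {X : Type*} {φ : X → X} {v : X → ℂ} {x : X} {N : ℕ}
    (h : UniformDecay Nat.succ (fun n => v (φ^[n] x)) (Ici N)) :
    UniformDecay φ v (trajectory φ (φ^[N] x)) := fun ε hε =>
  (h ε hε).imp fun m₀ hm₀ m hm y hy => by
    obtain ⟨n, rfl⟩ := hy
    have := hm₀ m hm (n + N) (mem_Ici.2 (Nat.le_add_left _ _))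
    rw [HyperbolicSplitting.weightProd_trajectory, iterate_add_apply] at this
    exact this

theorem UniformGrowth.of_sequence {X : Type*} {φ : X → X} {v : X → ℂ} {x : X}
    (h : UniformGrowth Nat.succ (fun n => v (φ^[n] x)) univ) :
    UniformGrowth φ v (trajectory φ x) := fun R =>
  (h R).imp fun m₀ hm₀ m hm y hy => by
    obtain ⟨n, rfl⟩ := hy
    have := hm₀ m hm n (mem_univ _)
    rwa [HyperbolicSplitting.weightProd_trajectory] at this

/-- Along a trajectory of isolated points starting outside `φ(X)`, the iterated weights either
decay or eventually grow. -/
theorem uniformDecay_or_uniformGrowth_trajectory (hφ : Injective φ) (hC : 1 ≤ C)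
    (hE : ∀ f : C(X, ℂ), (∀ x ∈ s, f x = 0) → ‖f‖ ≤ C * ‖f - weightedComp φ v f‖) {p : X}
    (hp : p ∉ range φ) (hiso : ∀ n : ℕ, IsOpen {φ^[n] p}) :
    UniformDecay φ v (trajectory φ p) ∨ ∃ N : ℕ, UniformGrowth φ v (trajectory φ (φ^[N] p)) := by
  have hpA : p ∈ univ \ φ '' univ := ⟨mem_univ _, by rwa [image_univ]⟩
  have hinj : Injective fun n : ℕ => φ^[n] p := fun m n h =>
    (iterate_inj_of_notMem_image hφ (mapsTo_univ φ univ) hpA hpA h).2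
  -- From index `N₀` on, only the starting point `x₀` can lie in `s`, and there the test sequences
  -- vanish.
  obtain ⟨N₀, hN₀⟩ := (s.finite_toSet.preimage hinj.injOn).bddAbove
  set x₀ := φ^[N₀] p with hx₀
  have hxn : ∀ n : ℕ, φ^[n] x₀ = φ^[n + N₀] p := fun n => (iterate_add_apply _ _ _ _).symm
  have hinj' : Injective fun n : ℕ => φ^[n] x₀ := fun m n h => by
    simp only [hxn] at h
    have := hinj h
    omega
  have hseq := uniformDecay_or_uniformGrowth (w := fun n => v (φ^[n] x₀)) hC (by
    intro f hfin hf0 D hD n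
    obtain ⟨F, hF, hF0⟩ := exists_continuousMap_of_null hinj' (fun i => by rw [hxn]; exact hiso _)
      f (fun ε hε => hfin.subset fun i hi => by
        intro h0
        have : ε ≤ ‖f i‖ := hi
        rw [h0, norm_zero] at this
        linarith)
    have hD0 : 0 ≤ D := (norm_nonneg _).trans (hD 0)
    have h1 : ‖F - weightedComp φ v F‖ ≤ D := by
      refine (ContinuousMap.norm_le _ hD0).2 fun y => ?_
      rw [ContinuousMap.sub_apply, weightedComp_apply]
      by_cases hy : y ∈ range fun n : ℕ => φ^[n] x₀
      · obtain ⟨j, rfl⟩ := hy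
        have h2 := hF (j + 1)
        simp only [iterate_succ_apply'] at h2
        rw [h2, hF j]
        exact hD j
      · rw [hF0 y hy]
        -- For `y` off the trajectory of `x₀`, injectivity allows `φ y` on it only as `x₀` itself,
        -- where `f 0 = 0`.
        have h2 : F (φ y) = 0 := by
          by_cases hy' : φ y ∈ range fun n : ℕ => φ^[n] x₀
          · obtain ⟨j, hj⟩ := hy'
            rcases j with _ | j
            · rw [← hj, hF 0, hf0]
            · refine absurd ⟨j, hφ ?_⟩ hy
              rw [← hj]
              exact (iterate_succ_apply' _ _ _).symm
          · exact hF0 _ hy'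
        simpa [h2] using hD0
    have h3 := hE F fun y hy => by
      by_cases hy' : y ∈ range fun n : ℕ => φ^[n] x₀
      · obtain ⟨j, rfl⟩ := hy'
        have h4 : j + N₀ ≤ N₀ := hN₀ (by
          change φ^[j + N₀] p ∈ s
          rw [← hxn]
          exact hy)
        obtain rfl : j = 0 := by omega
        rw [hF, hf0]
      · exact hF0 y hy'
    rw [← hF n]
    refine (F.norm_coe_le_norm _).trans (h3.trans ?_)
    gcongr)
  rcases hseq with ⟨N, hN⟩ | h
  · exact Or.inl hN.of_sequence.trajectory_of_iterate.trajectory_of_iterate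
  · exact Or.inr ⟨N₀, h.of_sequence⟩

end Estimate

/-! ### Building the splitting from the lower bound -/

section Construction

variable {X : Type*} [TopologicalSpace X] [CompactSpace X] [T2Space X] {φ : C(X, X)} {v : C(X, ℂ)}

theorem exists_splitting_of_estimate (hφ : Injective φ) {s : Finset X} {C : ℝ} (hC : 1 ≤ C)
    (hE : ∀ f : C(X, ℂ), (∀ x ∈ s, f x = 0) → ‖f‖ ≤ C * ‖f - weightedComp φ v f‖) :
    ∃ M₁ M₂ : Set X, M₁ ∪ M₂ = setM φ ∧ Disjoint M₁ M₂ ∧ IsClosed M₁ ∧ IsClosed M₂ ∧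
      MapsTo φ M₁ M₁ ∧ MapsTo φ M₂ M₂ ∧ UniformDecay φ v M₁ ∧
      UniformGrowth φ v (iterInter φ M₂) ∧ (M₂ \ φ '' M₂).Finite := by
  have himg : φ '' univ = range φ := image_univ
  set Y : Set X := univ \ φ '' univ with hY
  have hYr : ∀ p ∈ Y, p ∉ range φ := fun p hp => himg ▸ hp.2
  -- `F₀` holds the starting points whose trajectories meet `s`, finitely many as trajectories are
  -- disjoint; `G` is the union of all other trajectories, and `Gr` selects the eventually growing
  -- ones in `F₀`.
  set F₀ : Set X := {p ∈ Y | ∃ n : ℕ, φ^[n] p ∈ s} with hF₀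
  set G : Set X := ⋃ p ∈ Y \ F₀, trajectory φ p with hG
  set Gr : Set X := {p ∈ F₀ | ∃ N : ℕ, UniformGrowth φ v (trajectory φ (φ^[N] p))} with hGr
  have hF₀fin : F₀.Finite := by
    have : F₀ ⊆ ⋃ y ∈ (s : Set X), {p ∈ Y | ∃ n : ℕ, φ^[n] p = y} := fun p hp => by
      obtain ⟨hpY, n, hn⟩ := hp
      exact mem_biUnion (show φ^[n] p ∈ (s : Set X) from hn) ⟨hpY, n, rfl⟩
    refine (s.finite_toSet.biUnion fun y _ => Set.Subsingleton.finite ?_).subset this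
    rintro p ⟨hp, m, hm⟩ q ⟨hq, n, hn⟩
    exact (iterate_inj_of_notMem_image hφ (mapsTo_univ φ univ) hp hq (hm.trans hn.symm)).1
  have hGrfin : Gr.Finite := hF₀fin.subset (sep_subset _ _)
  have hGmaps : MapsTo φ G G := by
    intro x hx
    simp only [hG, mem_iUnion] at hx ⊢
    obtain ⟨p, hp, hx⟩ := hx
    exact ⟨p, hp, mapsTo_trajectory φ p hx⟩
  have hGcl : MapsTo φ (closure G) (closure G) := hGmaps.closure φ.continuous
  have hGdec : UniformDecay φ v (closure G) := by
    refine UniformDecay.closure φ.continuous v.continuous fun ε hε => ?_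
    obtain ⟨n₀, hn₀⟩ := exists_nat_gt (C * (C * 1) / ε)
    refine ⟨n₀, fun i hi x hx => ?_⟩
    simp only [hG, mem_iUnion] at hx
    obtain ⟨p, hp, k, rfl⟩ := hx
    have h1 := mul_weightProd_le_of_estimate hφ hC hE (hYr p hp.1)
      (fun n hn => hp.2 ⟨hp.1, n, hn⟩) k i
    rw [div_lt_iff₀ hε] at hn₀
    have h2 : (n₀ : ℝ) ≤ i := by exact_mod_cast hi
    have h3 : (n₀ : ℝ) * ε ≤ (i + 1) * ε := by gcongr; linarith
    have h4 : (0 : ℝ) < i + 1 := by positivity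
    exact le_of_mul_le_mul_left (h1.trans (hn₀.le.trans h3)) h4
  have hLc : (setL φ)ᶜ = G ∪ ⋃ p ∈ F₀, trajectory φ p := by
    ext x
    constructor
    · intro hx
      obtain ⟨p, hp, n, rfl⟩ := exists_iterate_of_notMem_iterInter (mem_univ x) hx
      by_cases hpF : p ∈ F₀
      · exact Or.inr (mem_biUnion hpF ⟨n, rfl⟩)
      · exact Or.inl (mem_biUnion (show p ∈ Y \ F₀ from ⟨hp, hpF⟩) ⟨n, rfl⟩)
    · have : ∀ p ∈ Y, ∀ x ∈ trajectory φ p, x ∈ (setL φ)ᶜ := by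
        rintro p hp _ ⟨n, rfl⟩ hL
        exact iterate_notMem_image_succ hφ hp.2 n (mem_iInter.1 hL (n + 1))
      rintro (hx | hx)
      · simp only [hG, mem_iUnion] at hx
        obtain ⟨p, hp, hx⟩ := hx
        exact this p hp.1 x hx
      · simp only [mem_iUnion] at hx
        obtain ⟨p, hp, hx⟩ := hx
        exact this p hp.1 x hx
  have hiso : ∀ p ∈ F₀, (∀ k : ℕ, φ^[k] p ∉ closure G) → ∀ n : ℕ, IsOpen {φ^[n] p} := by
    intro p hp hpG n
    set E : Set X := (fun a : X × ℕ => φ^[a.2] a.1) '' (F₀ ×ˢ Iic n) \ {φ^[n] p} with hEdef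
    have hEfin : E.Finite := ((hF₀fin.prod (finite_Iic n)).image _).subset sdiff_subset
    -- Outside `φ^(n+1)(X)` and `closure G` only points with index at most `n` on the finitely many
    -- trajectories from `F₀` survive.
    have heq : {φ^[n] p} = (φ^[n + 1] '' univ)ᶜ ∩ (closure G)ᶜ ∩ Eᶜ := by
      ext x
      constructor
      · rintro rfl
        exact ⟨⟨iterate_notMem_image_succ hφ hp.1.2 n, hpG n⟩, fun h => h.2 rfl⟩
      · rintro ⟨⟨hx1, hx2⟩, hx3⟩
        obtain ⟨q, hq, j, rfl⟩ := exists_iterate_of_notMem_iterInter (mem_univ x)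
          fun h => hx1 (mem_iInter.1 h (n + 1))
        have hqF : q ∈ F₀ := by
          by_contra hqF
          exact hx2 (subset_closure (mem_biUnion (show q ∈ Y \ F₀ from ⟨hq, hqF⟩) ⟨j, rfl⟩))
        have hjn : j ≤ n := by
          by_contra! hjn
          exact hx1 (antitone_image_iterate (mapsTo_univ φ univ) hjn ⟨q, mem_univ _, rfl⟩)
        by_contra hne
        exact hx3 ⟨⟨(q, j), ⟨hqF, hjn⟩, rfl⟩, hne⟩
    rw [heq]
    exact (((isCompact_univ.image (φ.continuous.iterate _)).isClosed.isOpen_compl).inter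
      isClosed_closure.isOpen_compl).inter hEfin.isClosed.isOpen_compl
  have hdec : ∀ p ∈ F₀ \ Gr, UniformDecay φ v (trajectory φ p) := by
    rintro p ⟨hp, hpGr⟩
    by_cases hk : ∃ k : ℕ, φ^[k] p ∈ closure G
    · obtain ⟨k, hk⟩ := hk
      refine UniformDecay.trajectory_of_iterate (k := k) (hGdec.mono ?_)
      rintro _ ⟨n, rfl⟩
      exact hGcl.iterate n hk
    · push Not at hk
      exact (uniformDecay_or_uniformGrowth_trajectory hφ hC hE (hYr p hp.1)
        (hiso p hp hk)).resolve_right fun h => hpGr ⟨hp, h⟩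
  set M₁ : Set X := closure G ∪ ⋃ p ∈ F₀ \ Gr, closure (trajectory φ p) with hM₁
  set M₂ : Set X := ⋃ p ∈ Gr, closure (trajectory φ p) with hM₂
  have htr : ∀ p, MapsTo φ (closure (trajectory φ p)) (closure (trajectory φ p)) := fun p =>
    (mapsTo_trajectory φ p).closure φ.continuous
  have hbi : ∀ t : Set X, MapsTo φ (⋃ p ∈ t, closure (trajectory φ p))
      (⋃ p ∈ t, closure (trajectory φ p)) := by
    intro t x hx
    simp only [mem_iUnion] at hx ⊢
    obtain ⟨p, hp, hx⟩ := hx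
    exact ⟨p, hp, htr p hx⟩
  have hM₁maps : MapsTo φ M₁ M₁ := fun x hx => hx.imp (fun h => hGcl h) fun h => hbi _ h
  have hM₁dec : UniformDecay φ v M₁ :=
    hGdec.union (UniformDecay.biUnion (hF₀fin.subset sdiff_subset) fun p hp =>
      (hdec p hp).closure φ.continuous v.continuous)
  have hshift : ∀ p (N N' : ℕ), N ≤ N' → MapsTo φ^[N'] (closure (trajectory φ p))
      (closure (trajectory φ (φ^[N] p))) := by
    intro p N N' hN
    refine MapsTo.closure ?_ (φ.continuous.iterate N')
    rintro _ ⟨n, rfl⟩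
    refine ⟨N' - N + n, ?_⟩
    simp only [← iterate_add_apply]
    congr 1
    omega
  refine ⟨M₁, M₂, ?_, ?_, ?_, ?_, hM₁maps, hbi _, hM₁dec, ?_, ?_⟩
  · rw [setM_eq, hLc, closure_union, hF₀fin.closure_biUnion, hM₁, hM₂, union_assoc,
      ← biUnion_union, sdiff_union_of_subset (sep_subset _ _)]
  -- A common point, moved `N` steps forward, would lie both in a set of decay and in a set of
  -- growth.
  · rw [Set.disjoint_left]
    intro x hx1 hx2
    simp only [hM₂, mem_iUnion] at hx2
    obtain ⟨p, ⟨-, N, hN⟩, hx2⟩ := hx2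
    exact Set.disjoint_left.1 (hM₁dec.not_growth (hN.closure φ.continuous v.continuous))
      (hM₁maps.iterate N hx1) (hshift p N N le_rfl hx2)
  · exact isClosed_closure.union
      ((hF₀fin.subset sdiff_subset).isClosed_biUnion fun _ _ => isClosed_closure)
  · exact hGrfin.isClosed_biUnion fun _ _ => isClosed_closure
  · have hex : ∀ p : X, ∃ N : ℕ, p ∈ Gr → UniformGrowth φ v (trajectory φ (φ^[N] p)) := fun p => by
      by_cases hp : p ∈ Gr
      · exact hp.2.imp fun _ h _ => h
      · exact ⟨0, fun h => absurd h hp⟩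
    choose N hN using hex
    -- Growth on the trajectory of `p` starts only after `N p` steps; points of `⋂ φⁿ(M₂)` lie in
    -- `φ^K(M₂)`, which is past all these delays.
    obtain ⟨K, hK⟩ := (hGrfin.image N).bddAbove
    have hgr : UniformGrowth φ v (⋃ p ∈ Gr, closure (trajectory φ (φ^[N p] p))) :=
      UniformGrowth.biUnion hGrfin fun p hp => (hN p hp).closure φ.continuous v.continuous
    refine fun R => (hgr R).imp fun n₀ h n hn x hx => h n hn x ?_
    obtain ⟨y, hy, rfl⟩ := mem_iInter.1 hx K
    simp only [hM₂, mem_iUnion] at hy ⊢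
    obtain ⟨p, hp, hy⟩ := hy
    exact ⟨p, hp, hshift p (N p) K (hK ⟨p, hp, rfl⟩) hy⟩
  · refine hGrfin.subset ?_
    rintro x ⟨hx, hxn⟩
    simp only [hM₂, mem_iUnion] at hx
    obtain ⟨p, hp, hx⟩ := hx
    have hcl : closure (trajectory φ p) ⊆ {p} ∪ φ '' closure (trajectory φ p) := by
      refine closure_minimal ?_ (isClosed_singleton.union
        (isClosed_closure.isCompact.image φ.continuous).isClosed)
      rintro _ ⟨n, rfl⟩
      rcases n with _ | n
      · exact Or.inl rfl
      · exact Or.inr ⟨φ^[n] p, subset_closure ⟨n, rfl⟩, (iterate_succ_apply' _ _ _).symm⟩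
    rcases hcl hx with h | ⟨y, hy, rfl⟩
    · rwa [mem_singleton_iff.1 h]
    · exact absurd ⟨y, mem_biUnion hp hy, rfl⟩ hxn

end Construction

/-! ### Invertibility over a bijection -/

section Invertible

variable {X : Type*} [TopologicalSpace X] [CompactSpace X] [T2Space X] (φ : C(X, X)) (w : C(X, ℂ))

/-- A weighted composition operator with nonvanishing weight over a bijection is invertible. -/
theorem isUnit_weightedComp (hφ : Bijective φ) (hw : ∀ x, w x ≠ 0) :
    IsUnit (weightedComp φ w) := by
  let e : X ≃ₜ X := Continuous.homeoOfEquivCompactToT2 (f := Equiv.ofBijective φ hφ) φ.continuous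
  have he : ∀ x, e x = φ x := fun _ => rfl
  let ψ : C(X, X) := ⟨e.symm, e.symm.continuous⟩
  have h1 : ∀ x, φ (ψ x) = x := fun x => e.apply_symm_apply x
  have h2 : ∀ x, ψ (φ x) = x := fun x => e.symm_apply_apply x
  let w' : C(X, ℂ) := ⟨fun x => (w (ψ x))⁻¹, (w.continuous.comp ψ.continuous).inv₀ fun x => hw _⟩
  have hw' : ∀ x, w' x = (w (ψ x))⁻¹ := fun _ => rfl
  refine ⟨⟨weightedComp φ w, weightedComp ψ w', ?_, ?_⟩, rfl⟩
  · ext f x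
    simp only [mul_apply_eq_comp, weightedComp_apply, hw', h2, one_apply_eq_self]
    rw [mul_inv_cancel_left₀ (hw x)]
  · ext f x
    simp only [mul_apply_eq_comp, weightedComp_apply, hw', h1, one_apply_eq_self]
    rw [inv_mul_cancel_left₀ (hw _)]

end Invertible

/-! ### The splitting conditions and the rescaling by `lam` -/

section Main

variable {X : Type*} [TopologicalSpace X] [CompactSpace X] [T2Space X] {φ : C(X, X)} {w : C(X, ℂ)}

theorem isSplitting_of_uniform (hφ : Injective φ) {c : ℂ} (hc : c ≠ 0) {M₁ M₂ : Set X}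
    (hunion : M₁ ∪ M₂ = setM φ) (hdisj : Disjoint M₁ M₂) (h₁c : IsClosed M₁) (h₂c : IsClosed M₂)
    (h₁ : MapsTo φ M₁ M₁) (h₂ : MapsTo φ M₂ M₂)
    (hdec : UniformDecay φ (c⁻¹ • w : C(X, ℂ)) M₁)
    (hgrow : UniformGrowth φ (c⁻¹ • w : C(X, ℂ)) (iterInter φ M₂))
    (hfin : (M₂ \ φ '' M₂).Finite) : IsSplitting φ w c M₁ M₂ := by
  have hc' : 0 < ‖c‖ := norm_pos_iff.2 hc
  have hsm : ∀ n x, ‖weightProd φ (c⁻¹ • w : C(X, ℂ)) n x‖ = ‖weightProd φ w n x‖ / ‖c‖ ^ n :=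
    fun n x => norm_weightProd_smul φ w n x
  refine ⟨hunion, hdisj, h₁c, h₂c, h₁, h₂, fun hne => ?_, fun hne => ?_, fun _ => hfin⟩
  · have := isCompact_iff_compactSpace.1 h₁c.isCompact
    have := hne.to_subtype
    obtain ⟨n₀, hn₀⟩ := hdec (1 / 2) (by norm_num)
    have hpos : 0 < ‖c‖ ^ (n₀ + 1) := pow_pos hc' _
    refine spectralRadius_lt_of_norm_pow_lt_continuousMap _ hc'.le (n := n₀ + 1) n₀.succ_ne_zero ?_
    refine (ContinuousLinearMap.opNorm_le_bound _ (M := 1 / 2 * ‖c‖ ^ (n₀ + 1)) (by positivity)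
      fun f => ?_).trans_lt (by linarith)
    refine (ContinuousMap.norm_le _ (by positivity)).2 fun x => ?_
    rw [weightedCompOn_pow_apply, norm_mul]
    have h1 := hn₀ (n₀ + 1) (Nat.le_succ _) x x.2
    rw [hsm, div_le_iff₀ hpos] at h1
    exact mul_le_mul h1 (f.norm_coe_le_norm _) (norm_nonneg _) (by positivity)
  · have hNc := isClosed_iterInter φ.continuous h₂c
    have := isCompact_iff_compactSpace.1 hNc.isCompact
    -- Nonemptiness gives the identity of `C(N₂)` norm `1`, needed to bound the spectral radius by
    -- norms of powers.
    have hNne : (iterInter φ M₂).Nonempty := by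
      by_contra he
      obtain ⟨n, hn⟩ := exists_image_iterate_subset φ.continuous h₂c h₂ isOpen_empty
        (not_nonempty_iff_eq_empty.1 he).le
      obtain ⟨x, hx⟩ := hne
      exact hn ⟨x, hx, rfl⟩
    have := hNne.to_subtype
    have hNm : MapsTo φ (iterInter φ M₂) (iterInter φ M₂) := mapsTo_iterInter h₂
    obtain ⟨n₀, hn₀⟩ := hgrow 2
    have hlow : ∀ x ∈ iterInter φ M₂, 2 * ‖c‖ ^ (n₀ + 1) ≤ ‖weightProd φ w (n₀ + 1) x‖ :=
      fun x hx => by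
        have h1 := hn₀ (n₀ + 1) (Nat.le_succ _) x hx
        rwa [hsm, le_div_iff₀ (pow_pos hc' _)] at h1
    have hpos : 0 < ‖c‖ ^ (n₀ + 1) := pow_pos hc' _
    have hsurj : ∀ n : ℕ, ∀ x ∈ iterInter φ M₂, ∃ y ∈ iterInter φ M₂, φ^[n] y = x := by
      intro n
      induction n with
      | zero => exact fun x hx => ⟨x, hx, rfl⟩
      | succ n ih =>
        intro x hx
        obtain ⟨y, hy, rfl⟩ := ih x hx
        obtain ⟨z, hz, rfl⟩ := exists_preimage_mem_iterInter hφ hy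
        exact ⟨z, hz, iterate_succ_apply _ _ _⟩
    have hunit : IsUnit (weightedCompOn φ w (iterInter φ M₂) hNm) := by
      refine isUnit_weightedComp _ _ ⟨fun x y hxy => ?_, fun x => ?_⟩ fun x => ?_
      · exact Subtype.ext (hφ (congrArg Subtype.val hxy))
      · obtain ⟨y, hy, hyx⟩ := exists_preimage_mem_iterInter hφ x.2
        exact ⟨⟨y, hy⟩, Subtype.ext hyx⟩
      · intro h0
        have h1 := hlow x x.2
        have h0 : w (x : X) = 0 := h0
        rw [weightProd_succ, h0, zero_mul, norm_zero] at h1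
        linarith
    obtain ⟨u, hu⟩ := hunit
    refine ⟨u, hu, ?_⟩
    rw [ofReal_lt_one_div_iff hc']
    refine spectralRadius_lt_of_norm_pow_lt_continuousMap _ (inv_nonneg.2 hc'.le)
      (n := n₀ + 1) n₀.succ_ne_zero ?_
    refine (ContinuousLinearMap.opNorm_le_bound _ (M := 1 / 2 * ‖c‖⁻¹ ^ (n₀ + 1)) (by positivity)
      fun f => ?_).trans_lt (by have := pow_pos (inv_pos.2 hc') (n₀ + 1); linarith)
    refine (ContinuousMap.norm_le _ (by positivity)).2 fun x => ?_
    set g := ((u⁻¹ : (C(iterInter φ M₂, ℂ) →L[ℂ] C(iterInter φ M₂, ℂ))ˣ) :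
      C(iterInter φ M₂, ℂ) →L[ℂ] C(iterInter φ M₂, ℂ)) ^ (n₀ + 1) with hg
    -- Evaluated at the preimage `y` of `x` under `φ^(n₀+1)`, this expresses `g f x` as `f y`
    -- divided by the iterated weight at `y`, which is at least `2 ‖c‖^(n₀+1)` in modulus.
    have h1 : (weightedCompOn φ w (iterInter φ M₂) hNm ^ (n₀ + 1)) (g f) = f := by
      rw [← hu, hg, ← mul_apply_eq_comp, ← Units.val_pow_eq_pow_val, ← Units.val_pow_eq_pow_val,
        inv_pow, Units.mul_inv]; rfl
    obtain ⟨y, hy, hyx⟩ := hsurj (n₀ + 1) x x.2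
    have h2 := congrArg norm (DFunLike.congr_fun h1 ⟨y, hy⟩)
    rw [weightedCompOn_pow_apply, norm_mul] at h2
    have h3 : (⟨φ^[n₀ + 1] y, hNm.iterate (n₀ + 1) hy⟩ : iterInter φ M₂) = x := Subtype.ext hyx
    simp only [h3] at h2
    have h4 := mul_le_mul_of_nonneg_right (hlow y hy) (norm_nonneg (g f x))
    have h5 := h2 ▸ h4
    have h6 : 2 * ‖c‖ ^ (n₀ + 1) * ‖g f x‖ ≤ ‖f‖ := h5.trans (f.norm_coe_le_norm _)
    rw [inv_pow]
    have h7 : 1 / 2 * (‖c‖ ^ (n₀ + 1))⁻¹ * ‖f‖ = ‖f‖ / (2 * ‖c‖ ^ (n₀ + 1)) := by field_simp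
    rw [h7, le_div_iff₀ (by positivity)]
    linarith

theorem exists_isSplitting (hφ : Injective φ) {c : ℂ} (hc : c ≠ 0)
    (h : IsUpperSemiFredholm (ContinuousLinearMap.id ℂ C(X, ℂ) - weightedComp φ (c⁻¹ • w))) :
    ∃ M₁ M₂ : Set X, IsSplitting φ w c M₁ M₂ := by
  obtain ⟨s, C, hC, hE⟩ := h.exists_estimate
  obtain ⟨M₁, M₂, h1, h2, h3, h4, h5, h6, h7, h8, h9⟩ := exists_splitting_of_estimate hφ hC hE
  exact ⟨M₁, M₂, isSplitting_of_uniform hφ hc h1 h2 h3 h4 h5 h6 h7 h8 h9⟩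

theorem smul_id_sub_weightedComp {X : Type*} [TopologicalSpace X] (φ : C(X, X)) (w : C(X, ℂ))
    {c : ℂ} (hc : c ≠ 0) : c • ContinuousLinearMap.id ℂ C(X, ℂ) - weightedComp φ w =
      c • (ContinuousLinearMap.id ℂ C(X, ℂ) - weightedComp φ (c⁻¹ • w)) := by
  ext f x
  change c * f x - w x * f (φ x) = c * (f x - c⁻¹ * w x * f (φ x))
  field_simp

theorem ker_smul_eq {E : Type*} [AddCommGroup E] [Module ℂ E] [TopologicalSpace E]
    [IsTopologicalAddGroup E] [ContinuousSMul ℂ E] (S : E →L[ℂ] E) {c : ℂ} (hc : c ≠ 0) :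
    LinearMap.ker ((c • S : E →L[ℂ] E) : E →ₗ[ℂ] E) = LinearMap.ker (S : E →ₗ[ℂ] E) :=
  LinearMap.ker_smul (S : E →ₗ[ℂ] E) c hc

theorem isUpperSemiFredholm_smul_iff {E : Type*} [AddCommGroup E] [Module ℂ E]
    [TopologicalSpace E] [IsTopologicalAddGroup E] [ContinuousSMul ℂ E] (S : E →L[ℂ] E) {c : ℂ}
    (hc : c ≠ 0) : IsUpperSemiFredholm (c • S) ↔ IsUpperSemiFredholm S := by
  have : range (c • S : E →L[ℂ] E) = range S :=
    congrArg (fun p : Submodule ℂ E => (p : Set E)) (LinearMap.range_smul (S : E →ₗ[ℂ] E) c hc)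
  rw [IsUpperSemiFredholm, IsUpperSemiFredholm, ker_smul_eq S hc, this]

end Main

theorem theorem2 {K : Type*} [TopologicalSpace K] [CompactSpace K] [T2Space K]
    (φ : C(K, K)) (hφ : Topology.IsEmbedding φ) (hφ' : range φ ≠ univ) (w : C(K, ℂ))
    (lam : ℂ) (hlam : lam ∈ spectrum ℂ (weightedComp φ w)) (hlam' : lam ≠ 0) :
    (IsUpperSemiFredholm
        (lam • ContinuousLinearMap.id ℂ C(K, ℂ) - weightedComp φ w) ↔
      IsUpperSemiFredholm (lam • ContinuousLinearMap.id ℂ C(setL φ, ℂ) -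
          weightedCompOn φ w (setL φ) (mapsTo_setL φ)) ∧
        ∃ M₁ M₂ : Set K, IsSplitting φ w lam M₁ M₂) ∧
    (IsUpperSemiFredholm
        (lam • ContinuousLinearMap.id ℂ C(K, ℂ) - weightedComp φ w) →
      ∀ M₁ M₂ : Set K, IsSplitting φ w lam M₁ M₂ →
        Module.finrank ℂ (LinearMap.ker ((lam • ContinuousLinearMap.id ℂ C(K, ℂ) -
            weightedComp φ w : C(K, ℂ) →L[ℂ] C(K, ℂ)) : C(K, ℂ) →ₗ[ℂ] C(K, ℂ))) =
          Module.finrank ℂ (LinearMap.ker ((lam • ContinuousLinearMap.id ℂ C(setL φ, ℂ) -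
            weightedCompOn φ w (setL φ) (mapsTo_setL φ) :
              C(setL φ, ℂ) →L[ℂ] C(setL φ, ℂ)) : C(setL φ, ℂ) →ₗ[ℂ] C(setL φ, ℂ))) +
          (M₂ \ φ '' M₂).ncard) := by
  have hinj : Function.Injective φ := hφ.injective
  rw [weightedCompOn, smul_id_sub_weightedComp φ w hlam', smul_id_sub_weightedComp _ _ hlam',
    isUpperSemiFredholm_smul_iff _ hlam', isUpperSemiFredholm_smul_iff _ hlam',
    ker_smul_eq _ hlam', ker_smul_eq _ hlam']
  have key : ∀ M₁ M₂ : Set K, IsSplitting φ w lam M₁ M₂ → _ := fun M₁ M₂ h =>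
    (hyperbolicSplitting_of_isSplitting hlam' h).isUpperSemiFredholm_iff_and_finrank hinj
  refine ⟨⟨fun h => ?_, fun ⟨hL, M₁, M₂, h⟩ => (key M₁ M₂ h).1.2 hL⟩,
    fun hS M₁ M₂ h => (key M₁ M₂ h).2 hS⟩
  obtain ⟨M₁, M₂, hM⟩ := exists_isSplitting hinj hlam' h
  exact ⟨(key M₁ M₂ hM).1.1 h, M₁, M₂, hM⟩
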